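/- **Setting.** Let $\mathcal D(\mathbb R^3)$ be the space of smooth compactly supported vector fields $f:\mathbb R^3\to\mathbb R^3$, with $\langle f,g\rangle=\int f(x)\cdot g(x)\,dx$. For open $O\subset\mathbb R^3$ let $\mathfrak W(O)$ be the $C^*$-algebra generated by the Weyl operators $e^{iA(f)},e^{iE(g)}$ with $f,g\in\mathcal D(\mathbb R^3)$ supported in $O$. These operators form unitary representations of the additive group $\mathcal D(\mathbb R^3)$ and satisfy $$e^{iA(f)}e^{iE(g)}=e^{i\langle f,g\rangle}e^{iE(g)}e^{iA(f)} .$$ Let $\mathfrak A(O)$ be the gauge invariant part of $\mathfrak W(O)$, i.e. the set of its elements commuting with $e^{iE(\operatorname{grad}s)}$ for all scalar test functions $s$. Put $e^{i\operatorname{div}E(s)}:=e^{-iE(\operatorname{grad}s)}$. Let $q\in\mathbb R$ and let $\gamma:[0,1]\to\mathbb R^3$ be a smooth injective path from $x_1$ to $x_2$ such that $|\gamma(u)-x_k|\ge R\,u(1-u)$ for $0<u<1$, $k=1,2$, and some $R>0$. Let $s_0$ be a scalar test function supported in the open ball of radius $R$ about $0$ with $\int s_0=q$. Put $\gamma_y(u)=\gamma(u)+u(1-u)y$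 and $$b_\varepsilon(x)=\int_\varepsilon^{1-\varepsilon}\!du\int dy\,s_0(y)\,\delta(x-\gamma_y(u))\,\dot\gamma_y(u)\qquad(\varepsilon>0),$$ which are test functions. The *gauge bridge* $\beta=\beta_{q,x_1x_2}$ is the pointwise norm limit on $\mathfrak A(\mathbb R^3)$ $$\beta(A)=\lim_{\varepsilon\searrow0}e^{iA(b_\varepsilon)}\,A\,e^{-iA(b_\varepsilon)} .$$ Let $\omega_\emptyset$ be a state on $\mathfrak A(\mathbb R^3)$ with $\omega_\emptyset(e^{i\operatorname{div}E(s)})=1$ for all scalar test functions $s$. Put $\mathscr X=\{x_1,x_2\}$. A *closed surface* is the boundary $\sigma=\partial\tau$ of a region $\tau$, where $\tau$ is the union of the images of finitely many smooth maps $[0,1]^3\to\mathbb R^3$ that are injective and orientation preserving on the open cube and whose images of the open cube are pairwise disjoint. It *encloses* $x$ if $x$ is an interior point of $\tau$. For a scalar test function $s$ with $\int s=1$, the surface function is $g_\sigma(x)=\int_\sigma s(x-y)\,n(y)\,d\sigma(y)$, with $n$ the outward unit normal. **Statement.** The limit $\beta$ exists and is an automorphism of $\mathfrak A(\mathbb R^3)$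 which maps $\mathfrak A(\mathbb R^3\setminus\mathscr X)$ onto itself. The functional $\omega_{\mathscr X}:=\omega_\emptyset\circ\beta$ on $\mathfrak A(\mathbb R^3\setminus\mathscr X)$ is a state, and: (i) $\omega_{\mathscr X}(e^{i\operatorname{div}E(s)})=1$ for all scalar test functions $s$ supported in $\mathbb R^3\setminus\mathscr X$. (ii) For every closed surface $\sigma\subset\mathbb R^3\setminus\mathscr X$ there is $\delta>0$ such that, for every scalar test function $s$ with $\int s=1$ and support in the ball of radius $\delta$ about $0$, the surface function $g_\sigma$ is supported in $\mathbb R^3\setminus\mathscr X$ and $$\omega_{\mathscr X}(e^{iE(g_\sigma)})=\begin{cases}1&\text{if }\sigma\text{ encloses none or both of }x_1,x_2,\\ e^{iq}&\text{if }\sigma\text{ encloses only }x_1,\\ e^{-iq}&\text{if }\sigma\text{ encloses only }x_2.\end{cases}$$ (iii) Let $O$ be an open set whose closure is compact, contained in $\mathbb R^3\setminus\mathscr X$, and contractible to a point within $\mathbb R^3\setminus\mathscr X$ (that is, the inclusion $\overline O\hookrightarrow\mathbb R^3\setminus\mathscr X$ is null-homotopic; for instance, $\overline O$ is contractible, or $\overline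 O$ lies in a contractible subset of $\mathbb R^3\setminus\mathscr X$). Then the restriction $\omega_{\mathscr X}\upharpoonright\mathfrak A(O)$ is a vector state in the GNS representation $(\pi,\mathcal H)$ of $\omega_\emptyset$: there is a unit vector $\Psi\in\mathcal H$ with $\omega_{\mathscr X}(A)=\langle\Psi,\pi(A)\Psi\rangle$ for all $A\in\mathfrak A(O)$. -/

import Mathlib

open Set Filter Topology MeasureTheory TopologicalSpace
open scoped ContDiff Distributions ComplexOrder

noncomputable section

namespace StaticCharges

/-- Physical space `ℝ³` with its Euclidean structure. -/
abbrev E3 : Type := EuclideanSpace ℝ (Fin 3)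

/-- Real scalar test functions on `ℝ³`. -/
abbrev ScalarTest : Type := 𝓓((⊤ : Opens E3), ℝ)

/-- Real vector-valued test functions on `ℝ³`. -/
abbrev VectorTest : Type := 𝓓((⊤ : Opens E3), E3)

/-! ### Two facts on integrals depending on a parameter

They are only used to see that the mollified integrals below are test functions. -/

theorem contDiff_integral_of_compact {T P : Type} {E F : Type}
    [TopologicalSpace T] [CompactSpace T] [MeasurableSpace T] [BorelSpace T]
    [NormedAddCommGroup P] [NormedSpace ℝ P]
    [NormedAddCommGroup E] [NormedSpace ℝ E] [ProperSpace E]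
    [NormedAddCommGroup F] [NormedSpace ℝ F]
    (μ : Measure T) [IsFiniteMeasure μ] (p : T → P) (hp : Continuous p)
    (Φ : P × E → F) (hΦ : ContDiff ℝ ∞ Φ) :
    ContDiff ℝ ∞ (fun x => ∫ t, Φ (p t, x) ∂μ) := by
  rw [contDiff_infty]
  intro n
  have hint : ∀ {G : Type} [NormedAddCommGroup G] [NormedSpace ℝ G] (h : T → G),
      Continuous h → Integrable h μ := by
    intro G _ _ h hh
    exact hh.integrable_of_hasCompactSupport (HasCompactSupport.of_compactSpace h)
  have key : ∀ {G : Type} [NormedAddCommGroup G] [NormedSpace ℝ G] (Ψ : P × E → G),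
      ContDiff ℝ ∞ Ψ → ∀ x, HasFDerivAt (fun x => ∫ t, Ψ (p t, x) ∂μ)
        (∫ t, (fderiv ℝ Ψ (p t, x)).comp (ContinuousLinearMap.inr ℝ P E) ∂μ) x := by
    intro G _ _ Ψ hΨ x
    have hc : Continuous (fun z : T × E =>
        (fderiv ℝ Ψ (p z.1, z.2)).comp (ContinuousLinearMap.inr ℝ P E)) := by
      have h1 : Continuous (fderiv ℝ Ψ) := hΨ.continuous_fderiv (by simp)
      exact (h1.comp ((hp.comp continuous_fst).prodMk continuous_snd)).clm_comp continuous_const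
    obtain ⟨C, hC⟩ := ((isCompact_univ (X := T)).prod
      (isCompact_closedBall x 1)).exists_bound_of_continuousOn hc.continuousOn
    refine hasFDerivAt_integral_of_dominated_of_fderiv_le (bound := fun _ => C)
      (Metric.closedBall_mem_nhds x one_pos)
      (Eventually.of_forall fun y => (hint _ ?_).aestronglyMeasurable)
      (hint _ ?_) (hint _ ?_).aestronglyMeasurable
      (Eventually.of_forall fun t y hy => hC (t, y) ⟨mem_univ _, hy⟩) (integrable_const _)
      (Eventually.of_forall fun t y _ => ?_)
    · exact hΨ.continuous.comp (hp.prodMk continuous_const)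
    · exact hΨ.continuous.comp (hp.prodMk continuous_const)
    · exact hc.comp (continuous_id.prodMk continuous_const)
    · have h2 : HasFDerivAt Ψ (fderiv ℝ Ψ (p t, y)) (p t, y) :=
        (hΨ.differentiable (by simp) _).hasFDerivAt
      exact h2.comp y (hasFDerivAt_prodMk_right (p t) y)
  induction n generalizing F with
  | zero =>
    rw [Nat.cast_zero, contDiff_zero]
    exact continuous_iff_continuousAt.2 fun x => (key Φ hΦ x).continuousAt
  | succ n ih =>
    rw [Nat.cast_succ, contDiff_succ_iff_hasFDerivAt]
    refine ⟨_, ih (fun z => (fderiv ℝ Φ z).comp (ContinuousLinearMap.inr ℝ P E)) ?_, key Φ hΦ⟩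
    exact (hΦ.fderiv_right (m := ∞) (by simp)).clm_comp contDiff_const

theorem contDiff_setIntegral_of_compact {T P : Type} {E F : Type}
    [TopologicalSpace T] [T2Space T] [MeasurableSpace T] [BorelSpace T]
    [NormedAddCommGroup P] [NormedSpace ℝ P]
    [NormedAddCommGroup E] [NormedSpace ℝ E] [ProperSpace E]
    [NormedAddCommGroup F] [NormedSpace ℝ F]
    (μ : Measure T) [IsFiniteMeasureOnCompacts μ] {K : Set T} (hK : IsCompact K)
    (p : T → P) (hp : ContinuousOn p K) (Φ : P × E → F) (hΦ : ContDiff ℝ ∞ Φ) :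
    ContDiff ℝ ∞ (fun x => ∫ t in K, Φ (p t, x) ∂μ) := by
  have : CompactSpace K := isCompact_iff_compactSpace.1 hK
  have hfin : IsFiniteMeasure (Measure.comap (Subtype.val : K → T) μ) := by
    refine ⟨?_⟩
    rw [(MeasurableEmbedding.subtype_coe hK.measurableSet).comap_apply]
    simpa using hK.measure_lt_top
  have h := contDiff_integral_of_compact (Measure.comap (Subtype.val : K → T) μ)
    (fun t => p t) (continuousOn_iff_continuous_domRestrict.1 hp) Φ hΦ
  have he : (fun x => ∫ t in K, Φ (p t, x) ∂μ) =
      fun x => ∫ t : K, Φ (p t, x) ∂Measure.comap (Subtype.val : K → T) μ :=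
    funext fun x => (integral_subtype_comap hK.measurableSet (fun t => Φ (p t, x))).symm
  rw [he]
  exact h

/-! ### Test functions: pairing and gradient -/

/-- `⟨f, g⟩ = ∫ f(x) · g(x) dx`. -/
def pairing (f g : VectorTest) : ℝ := ∫ x, inner ℝ (f x) (g x)

theorem integrable_inner (f g : VectorTest) : Integrable (fun x => inner ℝ (f x) (g x)) := by
  refine Continuous.integrable_of_hasCompactSupport (f.continuous.inner g.continuous) ?_
  exact f.hasCompactSupport.mono fun x hx h => hx (by simp [h])

theorem pairing_sub_left (f f' g : VectorTest) :
    pairing (f - f') g = pairing f g - pairing f' g := by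
  unfold pairing
  rw [← integral_sub (integrable_inner f g) (integrable_inner f' g)]
  exact integral_congr_ae (Eventually.of_forall fun x => inner_sub_left (f x) (f' x) (g x))

theorem pairing_neg_right (f g : VectorTest) : pairing f (-g) = -pairing f g := by
  unfold pairing
  rw [← integral_neg]
  exact integral_congr_ae (Eventually.of_forall fun x => inner_neg_right (f x) (g x))

theorem contDiff_gradient (s : ScalarTest) : ContDiff ℝ ∞ (gradient (s : E3 → ℝ)) :=
  (InnerProductSpace.toDual ℝ E3).symm.toContinuousLinearEquiv.contDiff.comp
    (s.contDiff.fderiv_right (m := ∞) (by simp))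

theorem tsupport_gradient_subset (s : ScalarTest) :
    tsupport (gradient (s : E3 → ℝ)) ⊆ tsupport s := by
  refine closure_minimal (fun x hx => ?_) (isClosed_tsupport _)
  refine support_fderiv_subset ℝ fun h => hx ?_
  simp [gradient, h]

/-- The gradient of a scalar test function. -/
def grad (s : ScalarTest) : VectorTest where
  toFun := gradient (s : E3 → ℝ)
  contDiff' := contDiff_gradient s
  hasCompactSupport' := s.hasCompactSupport.of_isClosed_subset (isClosed_tsupport _)
    (tsupport_gradient_subset s)
  tsupport_subset' := fun _ _ => trivial

/-! ### The Weyl algebra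

The Weyl relations with the nondegenerate form `⟨·,·⟩` have, up to isomorphism, one C*-algebra
generated by nonzero operators satisfying them. It is realised here in the (twisted) regular
representation on `ℓ²` of the group `𝓓(ℝ³) × 𝓓(ℝ³)`. -/

/-- The Hilbert space of the regular representation. -/
abbrev WeylSpace : Type := lp (fun _ : VectorTest × VectorTest => ℂ) 2

/-- `(T ψ)(i) = c(i) ψ(e(i))` for a bijection `e` of the index set and phases `c`. -/
def phaseShift {ι : Type} (e : ι ≃ ι) (c : ι → Circle) :
    lp (fun _ : ι => ℂ) 2 →ₗᵢ[ℂ] lp (fun _ : ι => ℂ) 2 where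
  toFun ψ := ⟨fun i => (c i : ℂ) * ψ (e i), by
    refine memℓp_gen ?_
    have h := (e.summable_iff (f := fun i => ‖ψ i‖ ^ (2 : ENNReal).toReal)).2
      ((lp.memℓp ψ).summable (by simp))
    simpa [Function.comp_def, Circle.norm_coe] using h⟩
  map_add' ψ φ := by
    ext i
    exact mul_add _ _ _
  map_smul' a ψ := by
    ext i
    simp [mul_left_comm]
  norm_map' ψ := by
    rw [lp.norm_eq_tsum_rpow (by simp), lp.norm_eq_tsum_rpow (by simp)]
    congr 1
    rw [← e.tsum_eq (fun i => ‖ψ i‖ ^ (2 : ENNReal).toReal)]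
    simp [Circle.norm_coe]

/-- Bounded operators on the Hilbert space of the regular representation. -/
abbrev Op : Type := WeylSpace →L[ℂ] WeylSpace

/-- The Weyl operator `e^{iA(f)}`: `(e^{iA(f)} ψ)(f', g') = ψ(f' - f, g')`. -/
def expA (f : VectorTest) : Op :=
  (phaseShift ((Equiv.subRight f).prodCongr (Equiv.refl VectorTest))
    (fun _ => 1)).toContinuousLinearMap

/-- The Weyl operator `e^{iE(g)}`: `(e^{iE(g)} ψ)(f', g') = e^{-i⟨f', g⟩} ψ(f', g' - g)`. -/
def expE (g : VectorTest) : Op :=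
  (phaseShift ((Equiv.refl VectorTest).prodCongr (Equiv.subRight g))
    (fun i => Circle.exp (-pairing i.1 g))).toContinuousLinearMap

theorem expA_apply (f : VectorTest) (ψ : WeylSpace) (i : VectorTest × VectorTest) :
    expA f ψ i = ψ (i.1 - f, i.2) := by
  simp [expA, phaseShift, Prod.map]

theorem expE_apply (g : VectorTest) (ψ : WeylSpace) (i : VectorTest × VectorTest) :
    expE g ψ i = (Circle.exp (-pairing i.1 g) : ℂ) * ψ (i.1, i.2 - g) := by
  simp [expE, phaseShift, Prod.map]

/-- The Weyl relations `e^{iA(f)} e^{iE(g)} = e^{i⟨f,g⟩} e^{iE(g)} e^{iA(f)}`. -/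
theorem weyl_relation (f g : VectorTest) :
    expA f * expE g = Complex.exp (Complex.I * pairing f g) • (expE g * expA f) := by
  ext ψ i
  simp only [mul_apply_eq_comp, smul_apply, lp.coeFn_smul,
    Pi.smul_apply, smul_eq_mul, expA_apply, expE_apply, Circle.coe_exp, ← mul_assoc]
  rw [← Complex.exp_add, pairing_sub_left]
  congr 2
  push_cast
  ring

theorem expE_comm (g g' : VectorTest) : expE g * expE g' = expE g' * expE g := by
  ext ψ i
  simp only [mul_apply_eq_comp, expE_apply]
  rw [sub_right_comm]
  ring

theorem expE_mul_neg (g : VectorTest) : expE g * expE (-g) = 1 := by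
  ext ψ i
  simp only [mul_apply_eq_comp, expE_apply, pairing_neg_right, Circle.coe_exp,
    ← mul_assoc, one_apply_eq_self]
  rw [← Complex.exp_add]
  simp

theorem star_expE (g : VectorTest) : star (expE g) = expE (-g) := by
  have h : star (expE g) * expE g = 1 :=
    (ContinuousLinearMap.norm_map_iff_adjoint_comp_self (expE g)).1
      (LinearIsometry.norm_map (phaseShift _ _))
  calc star (expE g) = star (expE g) * (expE g * expE (-g)) := by rw [expE_mul_neg, mul_one]
    _ = expE (-g) := by rw [← mul_assoc, h, one_mul]

/-- The local Weyl algebra `𝔚(O)`: the C*-algebra generated by the operators `e^{iA(f)}`,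
`e^{iE(g)}` with `f, g` supported in `O`. -/
def weylAlgebra (O : Opens E3) : StarSubalgebra ℂ Op :=
  (StarAlgebra.adjoin ℂ ({W | ∃ f : VectorTest, tsupport f ⊆ O ∧ W = expA f} ∪
    {W | ∃ g : VectorTest, tsupport g ⊆ O ∧ W = expE g})).topologicalClosure

/-- The local algebra of observables `𝔄(O)`: the gauge invariant part of `𝔚(O)`, that is the set of
its elements commuting with all operators `e^{iE(grad s)}`. -/
def observables (O : Opens E3) : StarSubalgebra ℂ Op :=
  weylAlgebra O ⊓ StarSubalgebra.centralizer ℂ {W | ∃ s : ScalarTest, W = expE (grad s)}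

theorem observables_mono {O O' : Opens E3} (h : O ≤ O') : observables O ≤ observables O' := by
  refine inf_le_inf_right _ (StarSubalgebra.topologicalClosure_mono (StarAlgebra.adjoin_mono ?_))
  refine union_subset_union ?_ ?_
  · rintro W ⟨f, hf, rfl⟩
    exact ⟨f, hf.trans h, rfl⟩
  · rintro W ⟨f, hf, rfl⟩
    exact ⟨f, hf.trans h, rfl⟩

theorem isClosed_observables (O : Opens E3) : IsClosed (observables O : Set Op) :=
  (StarSubalgebra.isClosed_topologicalClosure _).inter (Set.isClosed_centralizer _)

instance (O : Opens E3) : CompleteSpace (observables O) :=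
  (isClosed_observables O).completeSpace_coe

instance (O : Opens E3) : CStarAlgebra (observables O) where

/-- The usual order of a C*-algebra: `0 ≤ a` iff `a` is of the form `b⋆ b`. -/
instance (O : Opens E3) : PartialOrder (observables O) := CStarAlgebra.spectralOrder _

instance (O : Opens E3) : StarOrderedRing (observables O) := CStarAlgebra.spectralOrderedRing _

theorem expE_mem (O : Opens E3) (g : VectorTest) (hg : tsupport g ⊆ O) :
    expE g ∈ observables O := by
  refine ⟨StarSubalgebra.le_topologicalClosure _
    (StarAlgebra.subset_adjoin ℂ _ (Or.inr ⟨g, hg, rfl⟩)), ?_⟩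
  refine (StarSubalgebra.mem_centralizer_iff ℂ).2 ?_
  rintro W ⟨s, rfl⟩
  rw [star_expE]
  exact ⟨expE_comm _ _, expE_comm _ _⟩

/-- `e^{iE(g)}` as an element of `𝔄(O)`, for `g` supported in `O`. -/
def fieldE (O : Opens E3) (g : VectorTest) (hg : tsupport g ⊆ O) : observables O :=
  ⟨expE g, expE_mem O g hg⟩

theorem tsupport_neg_grad_subset (s : ScalarTest) {O : Set E3} (hs : tsupport s ⊆ O) :
    tsupport (-grad s : VectorTest) ⊆ O := by
  have h : ((-grad s : VectorTest) : E3 → E3) = -(gradient (s : E3 → ℝ)) := rfl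
  rw [h, tsupport_neg]
  exact (tsupport_gradient_subset s).trans hs

/-- `e^{i div E(s)} = e^{-iE(grad s)}` as an element of `𝔄(O)`, for `s` supported in `O`. -/
def chargeDensity (O : Opens E3) (s : ScalarTest) (hs : tsupport s ⊆ O) : observables O :=
  fieldE O (-grad s) (tsupport_neg_grad_subset s hs)

/-! ### Gauge bridges -/

/-- The data from which a gauge bridge between `x₁` and `x₂` with charge `q` is built: a smooth
simple path `γ` from `x₁` to `x₂`, which stays away from its end points in the quantitative sense
`|γ(u) - xₖ| ≥ R u (1 - u)`, and a scalar test function `s` of integral `q`, supported in the ball of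
radius `R`. -/
structure BridgeData (x₁ x₂ : E3) (q : ℝ) where
  path : ℝ → E3
  smooth : ContDiffOn ℝ ∞ path (Icc 0 1)
  simple : InjOn path (Icc 0 1)
  source : path 0 = x₁
  target : path 1 = x₂
  R : ℝ
  R_pos : 0 < R
  away_left : ∀ u ∈ Ioo (0 : ℝ) 1, R ≤ u⁻¹ * (1 - u)⁻¹ * ‖path u - x₁‖
  away_right : ∀ u ∈ Ioo (0 : ℝ) 1, R ≤ u⁻¹ * (1 - u)⁻¹ * ‖path u - x₂‖
  profile : ScalarTest
  profile_support : tsupport profile ⊆ Metric.ball 0 R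
  profile_integral : ∫ y, profile y = q

namespace BridgeData

variable {x₁ x₂ : E3} {q : ℝ} (D : BridgeData x₁ x₂ q)

/-- The neighbouring path `γ_y(u) = γ(u) + u (1 - u) y`. -/
def pathAt (y : E3) (u : ℝ) : E3 := D.path u + (u * (1 - u)) • y

/-- Its velocity `γ_y'(u) = γ'(u) + (1 - 2u) y`. -/
def velocityAt (y : E3) (u : ℝ) : E3 := derivWithin D.path (Icc 0 1) u + (1 - 2 * u) • y

/-- The vector field `a_u(x) = ∫ s(y) δ(x - γ_y(u)) γ_y'(u) dy`, for `0 < u < 1`. The substitution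
`z = γ_y(u)`, of Jacobian `(u (1 - u))³`, evaluates the Dirac measure at `y = (x - γ(u))/(u (1 - u))`
(see `integral_inner_slice`). -/
def slice (u : ℝ) (x : E3) : E3 :=
  (((u * (1 - u))⁻¹) ^ 3 * D.profile ((u * (1 - u))⁻¹ • (x - D.path u))) •
    D.velocityAt ((u * (1 - u))⁻¹ • (x - D.path u)) u

theorem integral_inner_slice {u : ℝ} (hu : u ∈ Ioo (0 : ℝ) 1) (g : VectorTest) :
    ∫ x, inner ℝ (D.slice u x) (g x) =
      ∫ y, D.profile y * inner ℝ (D.velocityAt y u) (g (D.pathAt y u)) := by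
  have hk : 0 < u * (1 - u) := mul_pos hu.1 (sub_pos.2 hu.2)
  rw [← integral_add_right_eq_self _ (D.path u)]
  have h := Measure.integral_comp_inv_smul_of_nonneg (volume : Measure E3)
    (fun y => ((u * (1 - u))⁻¹) ^ 3 *
      (D.profile y * inner ℝ (D.velocityAt y u) (g (D.pathAt y u)))) hk.le
  rw [integral_const_mul (_ ^ 3) (fun y => D.profile y * _), finrank_euclideanSpace_fin,
    smul_eq_mul, ← mul_assoc (_ ^ 3), ← mul_pow, mul_inv_cancel₀ hk.ne', one_pow, one_mul] at h
  rw [← h]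
  refine integral_congr_ae (Eventually.of_forall fun x => ?_)
  simp only [slice, pathAt, add_sub_cancel_right, inner_smul_left, smul_smul,
    mul_inv_cancel₀ hk.ne', one_smul]
  simp [mul_assoc, add_comm]

/-- `b_ε(x) = ∫_ε^{1-ε} a_u(x) du`. -/
def cutoffFun (ε : ℝ) (x : E3) : E3 := ∫ u in Icc ε (1 - ε), D.slice u x

theorem continuousOn_derivWithin : ContinuousOn (derivWithin D.path (Icc 0 1)) (Icc 0 1) :=
  D.smooth.continuousOn_derivWithin (uniqueDiffOn_Icc one_pos) (by simp)

theorem contDiff_cutoffFun {ε : ℝ} (hε : 0 < ε) : ContDiff ℝ ∞ (D.cutoffFun ε) := by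
  have hsub : Icc ε (1 - ε) ⊆ Icc 0 1 := Icc_subset_Icc hε.le (by linarith)
  have hk : ∀ u ∈ Icc ε (1 - ε), u * (1 - u) ≠ 0 := fun u hu =>
    (mul_pos (hε.trans_le hu.1) (by linarith [hu.2])).ne'
  have hp : ContinuousOn (fun u : ℝ => (((u * (1 - u))⁻¹, 1 - 2 * u),
      (D.path u, derivWithin D.path (Icc 0 1) u))) (Icc ε (1 - ε)) := by
    refine ContinuousOn.prodMk (ContinuousOn.prodMk ?_ ?_) (ContinuousOn.prodMk ?_ ?_)
    · exact ContinuousOn.inv₀ (by fun_prop) hk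
    · fun_prop
    · exact D.smooth.continuousOn.mono hsub
    · exact D.continuousOn_derivWithin.mono hsub
  have hs : ContDiff ℝ ∞ (D.profile : E3 → ℝ) := D.profile.contDiff
  refine contDiff_setIntegral_of_compact volume isCompact_Icc _ hp
    (fun z : ((ℝ × ℝ) × (E3 × E3)) × E3 =>
      ((z.1.1.1) ^ 3 * D.profile (z.1.1.1 • (z.2 - z.1.2.1))) •
        (z.1.2.2 + z.1.1.2 • (z.1.1.1 • (z.2 - z.1.2.1)))) ?_
  fun_prop

theorem hasCompactSupport_cutoffFun {ε : ℝ} (hε : 0 < ε) :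
    HasCompactSupport (D.cutoffFun ε) := by
  have hsub : Icc ε (1 - ε) ⊆ Icc 0 1 := Icc_subset_Icc hε.le (by linarith)
  have hc : IsCompact ((fun z : ℝ × E3 => D.pathAt z.2 z.1) ''
      (Icc ε (1 - ε) ×ˢ tsupport D.profile)) := by
    refine (isCompact_Icc.prod D.profile.hasCompactSupport).image_of_continuousOn ?_
    refine ContinuousOn.add ?_ (by fun_prop)
    exact (D.smooth.continuousOn.mono hsub).comp continuousOn_fst fun z hz => hz.1
  refine HasCompactSupport.of_support_subset_isCompact hc fun x hx => ?_
  by_contra hn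
  refine hx (setIntegral_eq_zero_of_forall_eq_zero fun u hu => ?_)
  have hk : u * (1 - u) ≠ 0 := (mul_pos (hε.trans_le hu.1) (by linarith [hu.2])).ne'
  have h0 : D.profile ((u * (1 - u))⁻¹ • (x - D.path u)) = 0 := by
    by_contra h
    refine hn ⟨(u, (u * (1 - u))⁻¹ • (x - D.path u)), ⟨hu, subset_tsupport _ h⟩, ?_⟩
    simp only [pathAt, smul_smul, mul_inv_cancel₀ hk, one_smul, add_sub_cancel]
  rw [slice, h0, mul_zero, zero_smul]

/-- The test function `b_ε`, `ε > 0` (the value for `ε ≤ 0` is irrelevant). -/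
def cutoff (ε : ℝ) : VectorTest :=
  if hε : 0 < ε then
    { toFun := D.cutoffFun ε
      contDiff' := D.contDiff_cutoffFun hε
      hasCompactSupport' := D.hasCompactSupport_cutoffFun hε
      tsupport_subset' := fun _ _ => trivial }
  else 0

/-- `β` is the gauge bridge belonging to the given data: the pointwise norm limit, for `ε ↘ 0`, of the
automorphisms `A ↦ e^{iA(b_ε)} A e^{-iA(b_ε)}` on the algebra of observables. -/
def IsGaugeBridge (β : observables ⊤ ≃⋆ₐ[ℂ] observables ⊤) : Prop :=
  ∀ A : observables ⊤, Tendsto (fun ε : ℝ => expA (D.cutoff ε) * (A : Op) * expA (-D.cutoff ε))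
    (𝓝[>] 0) (𝓝 (β A : Op))

end BridgeData

/-- The complement of `{x₁, x₂}`. -/
def awayFrom (x₁ x₂ : E3) : Opens E3 :=
  ⟨({x₁, x₂} : Set E3)ᶜ, (Set.toFinite _).isClosed.isOpen_compl⟩

/-- The inclusion `𝔄(O) ⊆ 𝔄(ℝ³)`. -/
def toGlobal (O : Opens E3) : observables O →⋆ₐ[ℂ] observables ⊤ :=
  StarSubalgebra.inclusion (observables_mono le_top)

/-- The functional `ω_X = ω₀ ∘ β` on `𝔄(ℝ³ ∖ X)`, `X = {x₁, x₂}`. -/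
def chargedState (x₁ x₂ : E3) (ω₀ : observables ⊤ →ₚ[ℂ] ℂ)
    (β : observables ⊤ ≃⋆ₐ[ℂ] observables ⊤) : observables (awayFrom x₁ x₂) →ₚ[ℂ] ℂ :=
  ω₀.comp (PositiveLinearMap.ofClass
    ((β : observables ⊤ →⋆ₐ[ℂ] observables ⊤).comp (toGlobal (awayFrom x₁ x₂))))

/-! ### Closed surfaces -/

/-- The vector product on `ℝ³`. -/
def cross (a b : E3) : E3 := WithLp.toLp 2 (crossProduct (WithLp.ofLp a) (WithLp.ofLp b))

/-- A smooth oriented surface patch `σ : [0,1]² → ℝ³`. -/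
structure Patch where
  toFun : (Fin 2 → ℝ) → E3
  smooth : ContDiffOn ℝ ∞ toFun (Icc 0 1)

namespace Patch

variable (σ : Patch)

/-- The surface normal `n_σ(u) = ∂₁σ(u) × ∂₂σ(u)`, whose length is the density of the surface
measure. -/
def normal (u : Fin 2 → ℝ) : E3 :=
  cross (fderivWithin ℝ σ.toFun (Icc 0 1) u (Pi.single 0 1))
    (fderivWithin ℝ σ.toFun (Icc 0 1) u (Pi.single 1 1))

theorem continuousOn_normal : ContinuousOn σ.normal (Icc 0 1) := by
  have hu : UniqueDiffOn ℝ (Icc (0 : Fin 2 → ℝ) 1) := by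
    rw [← Set.pi_univ_Icc]
    exact UniqueDiffOn.univ_pi fun _ => uniqueDiffOn_Icc one_pos
  have h := σ.smooth.continuousOn_fderivWithin hu (by simp)
  have h0 := h.clm_apply (continuousOn_const (c := (Pi.single 0 1 : Fin 2 → ℝ)))
  have h1 := h.clm_apply (continuousOn_const (c := (Pi.single 1 1 : Fin 2 → ℝ)))
  have hc : Continuous (fun z : E3 × E3 => cross z.1 z.2) := by
    unfold cross
    simp only [cross_apply]
    refine (PiLp.continuous_toLp 2 _).comp (continuous_pi fun i => ?_)
    fin_cases i <;> simp <;> fun_prop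
  exact hc.comp_continuousOn (h0.prodMk h1)

/-- The mollified surface `g_σ(x) = ∬ s(x - σ(u)) n_σ(u) d²u`. -/
def surfaceFun (s : ScalarTest) : VectorTest where
  toFun x := ∫ u in Icc 0 1, s (x - σ.toFun u) • σ.normal u
  contDiff' := by
    have hs : ContDiff ℝ ∞ (s : E3 → ℝ) := s.contDiff
    refine contDiff_setIntegral_of_compact volume isCompact_Icc
      (fun u => (σ.toFun u, σ.normal u)) (σ.smooth.continuousOn.prodMk σ.continuousOn_normal)
      (fun z : (E3 × E3) × E3 => s (z.2 - z.1.1) • z.1.2) ?_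
    fun_prop
  hasCompactSupport' := by
    have hc : IsCompact ((fun z : (Fin 2 → ℝ) × E3 => σ.toFun z.1 + z.2) ''
        (Icc 0 1 ×ˢ tsupport s)) := by
      refine (isCompact_Icc.prod s.hasCompactSupport).image_of_continuousOn ?_
      exact (σ.smooth.continuousOn.comp continuousOn_fst fun z hz => hz.1).add continuousOn_snd
    refine HasCompactSupport.of_support_subset_isCompact hc fun x hx => ?_
    by_contra hn
    refine hx (setIntegral_eq_zero_of_forall_eq_zero fun u hu => ?_)
    have h0 : s (x - σ.toFun u) = 0 := by
      by_contra h
      exact hn ⟨(u, x - σ.toFun u), ⟨hu, subset_tsupport _ h⟩, by simp⟩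
    simp [h0]
  tsupport_subset' := fun _ _ => trivial

end Patch

/-- The face of the unit cube on which the coordinate `k` is `1` (`top = true`) or `0`
(`top = false`), parametrised by `[0,1]²` so that it is oriented by the outward normal. -/
def face (k : Fin 3) (top : Bool) (u : Fin 2 → ℝ) : Fin 3 → ℝ := fun j =>
  if j = k then (if top then 1 else 0)
  else if j = k + 1 then (if top then u 0 else u 1)
  else (if top then u 1 else u 0)

theorem contDiff_face (k : Fin 3) (top : Bool) : ContDiff ℝ ∞ (face k top) := by
  refine contDiff_pi.2 fun j => ?_
  unfold face
  split_ifs <;> fun_prop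

theorem mapsTo_face (k : Fin 3) (top : Bool) : MapsTo (face k top) (Icc 0 1) (Icc 0 1) := by
  intro u hu
  have h0 := hu.1 0
  have h1 := hu.2 0
  have h2 := hu.1 1
  have h3 := hu.2 1
  constructor <;> intro j <;> simp only [face, Pi.zero_apply, Pi.one_apply] at * <;>
    split_ifs <;> first | assumption | norm_num

/-- A region of `ℝ³` with piecewise smooth boundary, fixed by finitely many smooth maps
`τ : [0,1]³ → ℝ³` of the unit cube, which on the open cube are orientation preserving and
injective, and whose images of the open cube do not overlap. (On the boundary of the cube the maps
may degenerate or be identified, as in spherical coordinates.) -/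
structure Region where
  ι : Type
  [fintype : Fintype ι]
  cell : ι → (Fin 3 → ℝ) → E3
  smooth : ∀ i, ContDiffOn ℝ ∞ (cell i) (Icc 0 1)
  injective : ∀ i j, ∀ u ∈ interior (Icc (0 : Fin 3 → ℝ) 1), ∀ v ∈ interior (Icc (0 : Fin 3 → ℝ) 1),
    cell i u = cell j v → i = j ∧ u = v
  oriented : ∀ i, ∀ u ∈ interior (Icc (0 : Fin 3 → ℝ) 1),
    0 < inner ℝ (fderiv ℝ (cell i) u (Pi.single 0 1))
      (cross (fderiv ℝ (cell i) u (Pi.single 1 1)) (fderiv ℝ (cell i) u (Pi.single 2 1)))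

namespace Region

variable (τ : Region)

instance : Fintype τ.ι := τ.fintype

/-- The points of the region. -/
def carrier : Set E3 := ⋃ i, τ.cell i '' Icc 0 1

/-- The points of the closed surface `σ = ∂τ`. -/
def surface : Set E3 := frontier τ.carrier

/-- The closed surface `σ = ∂τ` encloses `x` if `x` is an interior point of the region. -/
def Encloses (x : E3) : Prop := x ∈ interior τ.carrier

/-- The faces of the cells, oriented outwards. -/
def facePatch (i : τ.ι) (k : Fin 3) (top : Bool) : Patch where
  toFun := τ.cell i ∘ face k top
  smooth := (τ.smooth i).comp (contDiff_face k top).contDiffOn (mapsTo_face k top)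

/-- The surface function `g_σ` of the closed surface `σ = ∂τ`: the sum of the mollified surface
integrals over the outward oriented faces of the cells. Pieces along which cells are glued occur
twice, with opposite orientations, and drop out, so what remains is the integral over `σ`. -/
def surfaceFun (s : ScalarTest) : VectorTest :=
  ∑ i : τ.ι, ∑ k : Fin 3, ∑ top : Bool, (τ.facePatch i k top).surfaceFun s

end Region

end StaticCharges

end

/-!
The gauge bridge fixes every `e^{iA(f)}` and multiplies `e^{iE(g)}` by `e^{iℓ(g)}`, where
`ℓ(g) = lim ⟨b_ε, g⟩`; such an automorphism is implemented on `ℓ²` by multiplication with the phases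
`e^{iℓ(g')}`. The fundamental theorem of calculus along the paths `γ_y` gives
`ℓ(grad S) = q (S(x₂) - S(x₁))` whenever `S` is constant near `x₁` and near `x₂`. This yields (i),
and it yields (ii) because, by the divergence theorem, `g_σ = -grad S` for the mollified indicator
function `S` of the region enclosed by `σ`.

For (iii), let `K` be the closure of `O`. If `K` can be contracted off a point, then the component
of that point in the complement of `K` is unbounded: otherwise the contraction would extend to a
retraction of a ball onto its boundary sphere. Hence both charges lie in the unbounded component of
the complement, and the truncated bridge `b_ε` can be closed up off `K` to a divergence free test
function `b`. On `𝔄(O)` the bridge is then conjugation by `e^{iA(b)} ∈ 𝔄(ℝ³)`, so that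
`Ψ = π(e^{-iA(b)}) Ω` is the required vector.
-/

noncomputable section

namespace StaticCharges

/-! ### ⋆-homomorphisms and states of C*-algebras -/

section CStarAlgebra

variable {𝔄 𝔅 : Type*} [CStarAlgebra 𝔄] [CStarAlgebra 𝔅]

/-- The ⋆-subalgebra of the elements `A` on which a family of ⋆-homomorphisms `φ i` converges in
norm to `ψ A`. -/
def convergenceSubalgebra {ι : Type*} (l : Filter ι) (φ : ι → 𝔄 →⋆ₐ[ℂ] 𝔅) (ψ : 𝔄 →⋆ₐ[ℂ] 𝔅) :
    StarSubalgebra ℂ 𝔄 where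
  carrier := {A | Tendsto (fun i => φ i A) l (𝓝 (ψ A))}
  mul_mem' {A B} hA hB := by
    simp only [mem_ofPred_eq, map_mul] at *
    exact hA.mul hB
  add_mem' {A B} hA hB := by
    simp only [mem_ofPred_eq, map_add] at *
    exact hA.add hB
  algebraMap_mem' r := by
    simp only [mem_ofPred_eq, AlgHomClass.commutes]
    exact tendsto_const_nhds
  star_mem' {A} hA := by
    simp only [mem_ofPred_eq, map_star] at *
    exact hA.star

theorem isClosed_convergenceSubalgebra {ι : Type*} (l : Filter ι) (φ : ι → 𝔄 →⋆ₐ[ℂ] 𝔅)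
    (ψ : 𝔄 →⋆ₐ[ℂ] 𝔅) : IsClosed (convergenceSubalgebra l φ ψ : Set 𝔄) := by
  have contractive (χ : 𝔄 →⋆ₐ[ℂ] 𝔅) : LipschitzWith 1 χ :=
    AddMonoidHomClass.lipschitz_of_bound_nnnorm χ 1 fun A => by
      simpa only [one_mul] using NonUnitalStarAlgHom.nnnorm_apply_le χ A
  exact (LipschitzWith.uniformEquicontinuous _ 1
    fun i => contractive (φ i)).equicontinuous.isClosed_setOfPred_tendsto (contractive ψ).continuous

variable [PartialOrder 𝔄] [StarOrderedRing 𝔄] (φ : 𝔄 →ₚ[ℂ] ℂ)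

theorem inner_gnsStarAlgHom_toPreGNS (W A : 𝔄) :
    inner ℂ (φ.toPreGNS W : φ.GNS) (φ.gnsStarAlgHom A (φ.toPreGNS W : φ.GNS)) =
      φ (star W * (A * W)) := by
  change inner ℂ _ (φ.gnsNonUnitalStarAlgHom A _) = _
  rw [PositiveLinearMap.gnsNonUnitalStarAlgHom_apply_coe,
    UniformSpace.Completion.inner_coe, PositiveLinearMap.preGNS_inner_def]
  simp

theorem norm_toPreGNS_of_star_mul_self_eq_one (hφ : φ 1 = 1) {W : 𝔄} (hW : star W * W = 1) :
    ‖(φ.toPreGNS W : φ.GNS)‖ = 1 := by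
  rw [UniformSpace.Completion.norm_coe, PositiveLinearMap.preGNS_norm_def]
  simp [hW, hφ]

end CStarAlgebra

section Isometry

variable {H : Type*} [NormedAddCommGroup H] [InnerProductSpace ℂ H] [CompleteSpace H]

theorem star_isometry_eq_of_mul_eq_one (T : H →ₗᵢ[ℂ] H) {S : H →L[ℂ] H}
    (h : T.toContinuousLinearMap * S = 1) : star T.toContinuousLinearMap = S :=
  left_inv_eq_right_inv
    ((ContinuousLinearMap.norm_map_iff_adjoint_comp_self T.toContinuousLinearMap).1 T.norm_map) h

theorem isometry_mem_unitary_of_mul_eq_one (T : H →ₗᵢ[ℂ] H) {S : H →L[ℂ] H}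
    (h : T.toContinuousLinearMap * S = 1) : T.toContinuousLinearMap ∈ unitary (H →L[ℂ] H) :=
  Unitary.mem_iff.2
    ⟨(ContinuousLinearMap.norm_map_iff_adjoint_comp_self T.toContinuousLinearMap).1 T.norm_map,
      by rwa [star_isometry_eq_of_mul_eq_one T h]⟩

end Isometry

/-! ### Automorphisms fixing the `e^{iA(f)}` and multiplying the `e^{iE(g)}` by phases -/

theorem pairing_add_left (f f' g : VectorTest) :
    pairing (f + f') g = pairing f g + pairing f' g := by
  unfold pairing
  rw [← integral_add (integrable_inner f g) (integrable_inner f' g)]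
  exact integral_congr_ae (Eventually.of_forall fun x => inner_add_left (f x) (f' x) (g x))

theorem pairing_add_right (f g g' : VectorTest) :
    pairing f (g + g') = pairing f g + pairing f g' := by
  unfold pairing
  rw [← integral_add (integrable_inner f g) (integrable_inner f g')]
  exact integral_congr_ae (Eventually.of_forall fun x => inner_add_right (f x) (g x) (g' x))

theorem pairing_neg_left (f g : VectorTest) : pairing (-f) g = -pairing f g := by
  simpa [pairing] using pairing_sub_left 0 f g

theorem expA_zero : expA 0 = 1 := by
  ext ψ i
  simp [expA_apply]

theorem expA_add (f f' : VectorTest) : expA (f + f') = expA f * expA f' := by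
  ext ψ i
  simp only [mul_apply_eq_comp, expA_apply, sub_sub]

theorem expA_mul_neg (f : VectorTest) : expA f * expA (-f) = 1 := by
  rw [← expA_add, add_neg_cancel, expA_zero]

theorem star_expA (f : VectorTest) : star (expA f) = expA (-f) :=
  star_isometry_eq_of_mul_eq_one _ (expA_mul_neg f)

/-- `e^{iA(f)}` as a unitary operator. -/
def unitaryA (f : VectorTest) : unitary Op :=
  ⟨expA f, isometry_mem_unitary_of_mul_eq_one _ (expA_mul_neg f)⟩

theorem conj_unitaryA_apply (f : VectorTest) (A : Op) :
    Unitary.conjStarAlgAut ℂ Op (unitaryA f) A = expA f * A * expA (-f) := by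
  rw [Unitary.conjStarAlgAut_apply, unitaryA, star_expA]

/-- Multiplication by the phases `e^{iℓ(g')}` on `ℓ²`, where `g'` is the second component of the
index. It implements the automorphism `e^{iE(g)} ↦ e^{iℓ(g)} e^{iE(g)}` also when `ℓ` is not given
by pairing with a test function. -/
def phaseOp (ℓ : VectorTest →+ ℝ) : Op :=
  (phaseShift (Equiv.refl _)
    (fun i : VectorTest × VectorTest => Circle.exp (ℓ i.2))).toContinuousLinearMap

theorem phaseOp_apply (ℓ : VectorTest →+ ℝ) (ψ : WeylSpace) (i : VectorTest × VectorTest) :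
    phaseOp ℓ ψ i = (Circle.exp (ℓ i.2) : ℂ) * ψ i := by
  simp [phaseOp, phaseShift]

theorem phaseOp_mul_neg (ℓ : VectorTest →+ ℝ) : phaseOp ℓ * phaseOp (-ℓ) = 1 := by
  ext ψ i
  simp only [mul_apply_eq_comp, phaseOp_apply, Circle.coe_exp, one_apply_eq_self, ← mul_assoc,
    ← Complex.exp_add]
  simp

theorem star_phaseOp (ℓ : VectorTest →+ ℝ) : star (phaseOp ℓ) = phaseOp (-ℓ) :=
  star_isometry_eq_of_mul_eq_one _ (phaseOp_mul_neg ℓ)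

/-- Multiplication by the phases `e^{iℓ(g')}` as a unitary operator. -/
def unitaryPhase (ℓ : VectorTest →+ ℝ) : unitary Op :=
  ⟨phaseOp ℓ, isometry_mem_unitary_of_mul_eq_one _ (phaseOp_mul_neg ℓ)⟩

theorem conj_unitaryPhase_apply (ℓ : VectorTest →+ ℝ) (A : Op) :
    Unitary.conjStarAlgAut ℂ Op (unitaryPhase ℓ) A = phaseOp ℓ * A * phaseOp (-ℓ) := by
  rw [Unitary.conjStarAlgAut_apply, unitaryPhase, star_phaseOp]

/-- `α` fixes all `e^{iA(f)}` and multiplies `e^{iE(g)}` by `e^{i c(g)}`. The gauge bridge and the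
automorphisms approximating it are of this kind. -/
structure IsPhaseAut (α : Op ≃⋆ₐ[ℂ] Op) (c : VectorTest → ℝ) : Prop where
  map_expA : ∀ f, α (expA f) = expA f
  map_expE : ∀ g, α (expE g) = Complex.exp (Complex.I * c g) • expE g

theorem isPhaseAut_conj_unitaryA (f : VectorTest) :
    IsPhaseAut (Unitary.conjStarAlgAut ℂ Op (unitaryA f)) (pairing f) where
  map_expA f' := by
    rw [conj_unitaryA_apply, ← expA_add, ← expA_add, add_neg_cancel_comm]
  map_expE g := by
    rw [conj_unitaryA_apply, weyl_relation, smul_mul_assoc, mul_assoc, expA_mul_neg, mul_one]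

theorem isPhaseAut_conj_unitaryPhase (ℓ : VectorTest →+ ℝ) :
    IsPhaseAut (Unitary.conjStarAlgAut ℂ Op (unitaryPhase ℓ)) ℓ where
  map_expA f := by
    rw [conj_unitaryPhase_apply]
    ext ψ i
    simp only [mul_apply_eq_comp, phaseOp_apply, expA_apply, Circle.coe_exp, ← mul_assoc,
      ← Complex.exp_add]
    simp
  map_expE g := by
    rw [conj_unitaryPhase_apply]
    ext ψ i
    simp only [mul_apply_eq_comp, phaseOp_apply, expE_apply, smul_apply, lp.coeFn_smul,
      Pi.smul_apply, smul_eq_mul, Circle.coe_exp, ← mul_assoc, ← Complex.exp_add]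
    congr 2
    simp only [AddMonoidHom.neg_apply, map_sub]
    push_cast
    ring

theorem isClosed_weylAlgebra (O : Opens E3) : IsClosed (weylAlgebra O : Set Op) :=
  StarSubalgebra.isClosed_topologicalClosure _

theorem expA_mem_weylAlgebra {O : Opens E3} {f : VectorTest} (hf : tsupport f ⊆ O) :
    expA f ∈ weylAlgebra O :=
  StarSubalgebra.le_topologicalClosure _ (StarAlgebra.subset_adjoin ℂ _ (Or.inl ⟨f, hf, rfl⟩))

theorem expE_mem_weylAlgebra {O : Opens E3} {g : VectorTest} (hg : tsupport g ⊆ O) :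
    expE g ∈ weylAlgebra O :=
  StarSubalgebra.le_topologicalClosure _ (StarAlgebra.subset_adjoin ℂ _ (Or.inr ⟨g, hg, rfl⟩))

theorem weylAlgebra_le {O : Opens E3} {S : StarSubalgebra ℂ Op} (hS : IsClosed (S : Set Op))
    (hA : ∀ f : VectorTest, tsupport f ⊆ O → expA f ∈ S)
    (hE : ∀ g : VectorTest, tsupport g ⊆ O → expE g ∈ S) : weylAlgebra O ≤ S := by
  refine StarSubalgebra.topologicalClosure_minimal (StarAlgebra.adjoin_le ?_) hS
  rintro W (⟨f, hf, rfl⟩ | ⟨g, hg, rfl⟩)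
  exacts [hA f hf, hE g hg]

namespace IsPhaseAut

variable {α α' : Op ≃⋆ₐ[ℂ] Op} {c c' : VectorTest → ℝ} {O : Opens E3} {A : Op}

theorem symm (h : IsPhaseAut α c) : IsPhaseAut α.symm (fun g => -c g) where
  map_expA f := by rw [StarAlgEquiv.symm_apply_eq, h.map_expA]
  map_expE g := by
    rw [StarAlgEquiv.symm_apply_eq, map_smul, h.map_expE, smul_smul, ← Complex.exp_add]
    simp

theorem map_mem_weylAlgebra (h : IsPhaseAut α c) (hA : A ∈ weylAlgebra O) :
    α A ∈ weylAlgebra O := by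
  suffices weylAlgebra O ≤ (weylAlgebra O).comap (α : Op →⋆ₐ[ℂ] Op) from this hA
  refine weylAlgebra_le ((isClosed_weylAlgebra O).preimage (map_continuous α))
    (fun f hf => ?_) fun g hg => ?_
  · change α (expA f) ∈ weylAlgebra O
    rw [h.map_expA]
    exact expA_mem_weylAlgebra hf
  · change α (expE g) ∈ weylAlgebra O
    rw [h.map_expE]
    exact SMulMemClass.smul_mem _ (expE_mem_weylAlgebra hg)

theorem commute_expE_map (h : IsPhaseAut α c) {g : VectorTest} (hA : expE g * A = A * expE g) :
    expE g * α A = α A * expE g := by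
  have := congrArg α hA
  rw [map_mul, map_mul, h.map_expE, smul_mul_assoc, mul_smul_comm] at this
  exact smul_right_injective Op (Complex.exp_ne_zero _) this

theorem map_mem_observables (h : IsPhaseAut α c) (hA : A ∈ observables O) :
    α A ∈ observables O := by
  refine ⟨h.map_mem_weylAlgebra hA.1, (StarSubalgebra.mem_centralizer_iff ℂ).2 ?_⟩
  rintro W ⟨s, rfl⟩
  have hs := (StarSubalgebra.mem_centralizer_iff ℂ).1 hA.2 _ ⟨s, rfl⟩
  rw [star_expE] at hs ⊢
  exact ⟨h.commute_expE_map hs.1, h.commute_expE_map hs.2⟩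

theorem mem_observables_iff (h : IsPhaseAut α c) : A ∈ observables O ↔ α A ∈ observables O :=
  ⟨h.map_mem_observables, fun hA => by simpa using h.symm.map_mem_observables hA⟩

theorem eqOn_weylAlgebra (h : IsPhaseAut α c) (h' : IsPhaseAut α' c')
    (hc : ∀ g : VectorTest, tsupport g ⊆ O → c g = c' g) (hA : A ∈ weylAlgebra O) :
    α A = α' A := by
  suffices weylAlgebra O ≤ StarAlgHom.equalizer (α : Op →⋆ₐ[ℂ] Op) (α' : Op →⋆ₐ[ℂ] Op) from this hA
  refine weylAlgebra_le (isClosed_eq (map_continuous α) (map_continuous α'))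
    (fun f _ => ?_) fun g hg => ?_
  · change α (expA f) = α' (expA f)
    rw [h.map_expA, h'.map_expA]
  · change α (expE g) = α' (expE g)
    rw [h.map_expE, h'.map_expE, hc g hg]

theorem tendsto_of_tendsto_phase {ι : Type*} {l : Filter ι} {α : ι → Op ≃⋆ₐ[ℂ] Op}
    {c : ι → VectorTest → ℝ} (h : ∀ i, IsPhaseAut (α i) (c i)) (h' : IsPhaseAut α' c')
    (hc : ∀ g : VectorTest, tsupport g ⊆ O → Tendsto (fun i => c i g) l (𝓝 (c' g)))
    (hA : A ∈ weylAlgebra O) : Tendsto (fun i => α i A) l (𝓝 (α' A)) := by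
  suffices weylAlgebra O ≤
    convergenceSubalgebra l (fun i => (α i : Op →⋆ₐ[ℂ] Op)) (α' : Op →⋆ₐ[ℂ] Op) from this hA
  refine weylAlgebra_le (isClosed_convergenceSubalgebra l _ _) (fun f _ => ?_) fun g hg => ?_
  · change Tendsto (fun i => α i (expA f)) l (𝓝 (α' (expA f)))
    simp only [(h _).map_expA, h'.map_expA]
    exact tendsto_const_nhds
  · change Tendsto (fun i => α i (expE g)) l (𝓝 (α' (expE g)))
    simp only [(h _).map_expE, h'.map_expE]
    have hphase : Continuous fun r : ℝ => Complex.exp (Complex.I * r) := by fun_prop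
    exact ((hphase.tendsto _).comp (hc g hg)).smul_const _

/-- The restriction of a phase automorphism to the observables localized in `O`. -/
def restrict (h : IsPhaseAut α c) (O : Opens E3) : observables O ≃⋆ₐ[ℂ] observables O where
  toFun A := ⟨α A, h.map_mem_observables A.2⟩
  invFun A := ⟨α.symm A, h.symm.map_mem_observables A.2⟩
  left_inv _ := Subtype.ext (α.symm_apply_apply _)
  right_inv _ := Subtype.ext (α.apply_symm_apply _)
  map_mul' _ _ := Subtype.ext (map_mul α _ _)
  map_add' _ _ := Subtype.ext (map_add α _ _)
  map_star' _ := Subtype.ext (map_star α _)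
  map_smul' r _ := Subtype.ext (map_smul α r _)

end IsPhaseAut

theorem expA_mem_observables {O : Opens E3} {b : VectorTest} (hbO : tsupport b ⊆ O)
    (hb : ∀ S, pairing b (grad S) = 0) : expA b ∈ observables O := by
  refine ⟨expA_mem_weylAlgebra hbO, (StarSubalgebra.mem_centralizer_iff ℂ).2 ?_⟩
  have commute_of_pairing_eq_zero (g : VectorTest) (hg : pairing b g = 0) :
      expE g * expA b = expA b * expE g := by
    rw [weyl_relation, hg]
    simp
  rintro W ⟨S, rfl⟩
  rw [star_expE]
  exact ⟨commute_of_pairing_eq_zero _ (hb S),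
    commute_of_pairing_eq_zero _ (by rw [pairing_neg_right, hb, neg_zero])⟩

/-! ### There is no retraction of a ball onto its sphere -/

section Determinant

variable {V : Type*} [AddCommGroup V] [Module ℝ V] [FiniteDimensional ℝ V]

theorem exists_polynomial_eval_eq_det_one_add_smul (A : Module.End ℝ V) :
    ∃ p : Polynomial ℝ, p.natDegree ≤ Module.finrank ℝ V ∧
      ∀ t : ℝ, p.eval t = LinearMap.det (1 + t • A) := by
  let b := Module.finBasis ℝ V
  let M := LinearMap.toMatrix b b A
  refine ⟨_, (Polynomial.natDegree_det_X_add_C_le M 1).trans_eq (Fintype.card_fin _), fun t => ?_⟩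
  rw [← Polynomial.coe_evalRingHom, RingHom.map_det, ← LinearMap.det_toMatrix b]
  congr 1
  ext i j
  rcases eq_or_ne i j with rfl | hij <;>
    simp [M, LinearMap.toMatrix_one, add_comm, mul_comm t, *]

theorem det_one_add_eq_sum_lagrange (A : Module.End ℝ V) {s : Finset ℝ}
    (hs : Module.finrank ℝ V < s.card) :
    LinearMap.det (1 + A) =
      ∑ t ∈ s, (Lagrange.basis s id t).eval 1 * LinearMap.det (1 + t • A) := by
  obtain ⟨p, hdeg, hp⟩ := exists_polynomial_eval_eq_det_one_add_smul A
  have hlt : p.degree < s.card :=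
    Polynomial.degree_le_natDegree.trans_lt (by exact_mod_cast hdeg.trans_lt hs)
  calc LinearMap.det (1 + A) = p.eval 1 := by rw [hp, one_smul]
    _ = _ := by
      conv_lhs => rw [Lagrange.eq_interpolate (injOn_id _) hlt, Lagrange.interpolate_apply]
      simp [Polynomial.eval_finsetSum, hp, mul_comm]

end Determinant

section Retraction

variable {E : Type*} [NormedAddCommGroup E]

section Deformation

variable [NormedSpace ℝ E]

theorem image_ball_of_isOpen_of_fix_sphere [ProperSpace E] {f : E → E} {a : E} {R : ℝ} (hR : 0 < R)
    (hf : ContinuousOn f (Metric.closedBall a R)) (hopen : IsOpen (f '' Metric.ball a R))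
    (hmaps : MapsTo f (Metric.ball a R) (Metric.ball a R)) (hfix : EqOn f id (Metric.sphere a R)) :
    f '' Metric.ball a R = Metric.ball a R := by
  refine hmaps.image_subset.antisymm ?_
  refine (convex_ball a R).isPreconnected.subset_of_closure_inter_subset hopen ?_ ?_
  · have ha := Metric.mem_ball_self (x := a) hR
    exact ⟨f a, hmaps ha, mem_image_of_mem f ha⟩
  · rintro y ⟨hy, hyR⟩
    have hcl : IsClosed (f '' Metric.closedBall a R) :=
      ((isCompact_closedBall a R).image_of_continuousOn hf).isClosed
    obtain ⟨x, hx, rfl⟩ := closure_minimal (image_mono Metric.ball_subset_closedBall) hcl hy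
    rcases Metric.ball_union_sphere.symm.subset hx with hx | hx
    · exact mem_image_of_mem f hx
    · rw [hfix hx] at hyR
      exact absurd hx hyR.ne

theorem mapsTo_ball_deformation {r : E → E} {a : E} {R t : ℝ}
    (hmaps : MapsTo r (Metric.ball a R) (Metric.closedBall a R)) (ht : t ∈ Ioo (0 : ℝ) 1) :
    MapsTo (fun x => x + t • (r x - x)) (Metric.ball a R) (Metric.ball a R) := by
  intro x hx
  have hrx := hmaps hx
  rw [mem_ball_iff_norm] at hx ⊢
  rw [mem_closedBall_iff_norm] at hrx
  calc ‖x + t • (r x - x) - a‖ = ‖(1 - t) • (x - a) + t • (r x - a)‖ := by congr 1; module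
    _ ≤ (1 - t) * ‖x - a‖ + t * ‖r x - a‖ := by
      refine (norm_add_le _ _).trans_eq ?_
      rw [norm_smul, norm_smul, Real.norm_of_nonneg (sub_pos.2 ht.2).le,
        Real.norm_of_nonneg ht.1.le]
    _ < R := by nlinarith [ht.1, ht.2]

theorem approximatesLinearOn_id_add_smul {g : E → E} {s : Set E} {C : NNReal}
    (hg : LipschitzOnWith C g s) (t : ℝ) :
    ApproximatesLinearOn (fun x => x + t • g x) (ContinuousLinearEquiv.refl ℝ E : E →L[ℝ] E) s
      (‖t‖₊ * C) := by
  intro x hx y hy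
  calc ‖x + t • g x - (y + t • g y) - (x - y)‖ = ‖t‖ * ‖g x - g y‖ := by
        rw [← norm_smul]; congr 1; module
    _ ≤ ‖t‖ * (C * ‖x - y‖) := by gcongr; exact hg.norm_sub_le hx hy
    _ = _ := by rw [NNReal.coe_mul, coe_nnnorm, mul_assoc]

theorem isOpen_image_and_injOn_of_approximatesLinearOn_id [CompleteSpace E] {f : E → E} {s : Set E}
    {c : NNReal}
    (hf : ApproximatesLinearOn f (ContinuousLinearEquiv.refl ℝ E : E →L[ℝ] E) s c) (hc : c < 1)
    (hs : IsOpen s) : IsOpen (f '' s) ∧ InjOn f s := by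
  have hc' : Subsingleton E ∨
      c < ‖((ContinuousLinearEquiv.refl ℝ E).symm : E →L[ℝ] E)‖₊⁻¹ := by
    rcases subsingleton_or_nontrivial E with hE | hE
    · exact Or.inl hE
    · have hid : ‖((ContinuousLinearEquiv.refl ℝ E).symm : E →L[ℝ] E)‖₊ = 1 :=
        ContinuousLinearMap.nnnorm_id
      exact Or.inr (by rwa [hid, inv_one])
  exact ⟨(hf.toOpenPartialHomeomorph f s hc' hs).open_target, hf.injOn hc'⟩

theorem eventually_forall_det_one_add_smul_pos {K : Set E} (hK : IsCompact K) {A : E → E →L[ℝ] E}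
    (hA : Continuous A) : ∀ᶠ t : ℝ in 𝓝 0, ∀ x ∈ K, 0 < (1 + t • A x).det := by
  refine hK.eventually_forall_of_forall_eventually fun x _ => ?_
  have hdet : Continuous fun z : ℝ × E => (1 + z.1 • A z.2).det :=
    ContinuousLinearMap.continuous_det.comp (by fun_prop)
  refine hdet.continuousAt.eventually (lt_mem_nhds ?_)
  simp [ContinuousLinearMap.det]

variable [FiniteDimensional ℝ E] [MeasurableSpace E] [BorelSpace E] (μ : Measure E)
  [μ.IsAddHaarMeasure]
  {r : E → E} {a : E} {R : ℝ}

theorem eventually_setIntegral_det_deformation (hR : 0 < R) (hr : ContDiff ℝ 1 r)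
    (hmaps : MapsTo r (Metric.closedBall a R) (Metric.closedBall a R))
    (hfix : EqOn r id (Metric.sphere a R)) :
    ∀ᶠ t : ℝ in 𝓝[>] 0, ∫ x in Metric.ball a R, (1 + t • (fderiv ℝ r x - 1)).det ∂μ =
      μ.real (Metric.ball a R) := by
  have hcont : Continuous fun x => fderiv ℝ r x - 1 :=
    (hr.continuous_fderiv one_ne_zero).sub continuous_const
  obtain ⟨C, hC⟩ :=
    (isCompact_closedBall a R).exists_bound_of_continuousOn hcont.continuousOn
  have hderiv (x : E) : HasFDerivAt (fun x => r x - x) (fderiv ℝ r x - 1) x :=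
    (hr.differentiable one_ne_zero x).hasFDerivAt.sub (hasFDerivAt_id x)
  have hlip : LipschitzOnWith C.toNNReal (fun x => r x - x) (Metric.ball a R) :=
    (convex_ball a R).lipschitzOnWith_of_nnnorm_hasFDerivWithin_le
      (fun x _ => (hderiv x).hasFDerivWithinAt)
      fun x hx => NNReal.le_toNNReal_of_coe_le (hC x (Metric.ball_subset_closedBall hx))
  have hsmall : ∀ᶠ t : ℝ in 𝓝 0, ‖t‖₊ * C.toNNReal < 1 := by
    have : Continuous fun t : ℝ => ‖t‖₊ * C.toNNReal := by fun_prop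
    exact this.continuousAt.eventually (gt_mem_nhds (by simp))
  filter_upwards [nhdsWithin_le_nhds hsmall, Ioo_mem_nhdsGT one_pos,
    nhdsWithin_le_nhds (eventually_forall_det_one_add_smul_pos (isCompact_closedBall a R) hcont)]
    with t htC ht hdet
  obtain ⟨hopen, hinj⟩ := isOpen_image_and_injOn_of_approximatesLinearOn_id
    (approximatesLinearOn_id_add_smul hlip t) htC Metric.isOpen_ball
  have himage : (fun x => x + t • (r x - x)) '' Metric.ball a R = Metric.ball a R :=
    image_ball_of_isOpen_of_fix_sphere hR (by have := hr.continuous; fun_prop) hopen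
      (mapsTo_ball_deformation (hmaps.mono_left Metric.ball_subset_closedBall) ht)
      fun x hx => by simp [hfix hx]
  calc ∫ x in Metric.ball a R, (1 + t • (fderiv ℝ r x - 1)).det ∂μ
      = ∫ x in Metric.ball a R, |(1 + t • (fderiv ℝ r x - 1)).det| • (1 : ℝ) ∂μ :=
        setIntegral_congr_fun Metric.isOpen_ball.measurableSet fun x hx => by
          simp only [abs_of_pos (hdet x (Metric.ball_subset_closedBall hx)), smul_eq_mul, mul_one]
    _ = ∫ _ in (fun x => x + t • (r x - x)) '' Metric.ball a R, (1 : ℝ) ∂μ :=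
        (integral_image_eq_integral_abs_det_fderiv_smul μ Metric.isOpen_ball.measurableSet
          (fun x _ => ((hasFDerivAt_id x).add ((hderiv x).const_smul t)).hasFDerivWithinAt)
          hinj fun _ => (1 : ℝ)).symm
    _ = μ.real (Metric.ball a R) := by simp [himage]

/-- The integral of `det (1 + t (r' - 1))` is a polynomial in `t`. For small `t > 0` it is the volume
of the ball, which `x ↦ x + t (r x - x)` maps bijectively onto itself, hence also for `t = 1`
(Milnor, Rogers). -/
theorem setIntegral_det_fderiv_eq (hR : 0 < R) (hr : ContDiff ℝ 1 r)
    (hmaps : MapsTo r (Metric.closedBall a R) (Metric.closedBall a R))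
    (hfix : EqOn r id (Metric.sphere a R)) :
    ∫ x in Metric.ball a R, (fderiv ℝ r x).det ∂μ = μ.real (Metric.ball a R) := by
  have hcont : Continuous fun x => fderiv ℝ r x - 1 :=
    (hr.continuous_fderiv one_ne_zero).sub continuous_const
  obtain ⟨t₀, ht₀ : 0 < t₀, hsmall⟩ := mem_nhdsGT_iff_exists_Ioo_subset.1
    (eventually_setIntegral_det_deformation μ hR hr hmaps hfix)
  obtain ⟨s, hs, hcard⟩ := (Ioo_infinite ht₀).exists_subset_card_eq (Module.finrank ℝ E + 1)
  have hlt : Module.finrank ℝ E < s.card := hcard ▸ Nat.lt_succ_self _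
  have hint (t : ℝ) : Integrable (fun x => (1 + t • (fderiv ℝ r x - 1)).det)
      (μ.restrict (Metric.ball a R)) :=
    (((ContinuousLinearMap.continuous_det.comp
      (continuous_const.add (hcont.const_smul t))).continuousOn.integrableOn_compact
      (isCompact_closedBall a R)).mono_set Metric.ball_subset_closedBall)
  have hexpand (x : E) : (fderiv ℝ r x).det =
      ∑ t ∈ s, (Lagrange.basis s id t).eval 1 * (1 + t • (fderiv ℝ r x - 1)).det := by
    have := det_one_add_eq_sum_lagrange ((fderiv ℝ r x - 1 : E →L[ℝ] E) : E →ₗ[ℝ] E) hlt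
    simpa [ContinuousLinearMap.det] using this
  have hbasis : ∑ t ∈ s, (Lagrange.basis s id t).eval 1 = 1 := by
    rw [← Polynomial.eval_finsetSum, Lagrange.sum_basis (injOn_id _), Polynomial.eval_one]
    exact Finset.card_pos.1 (Nat.zero_lt_of_lt hlt)
  calc ∫ x in Metric.ball a R, (fderiv ℝ r x).det ∂μ
      = ∑ t ∈ s, (Lagrange.basis s id t).eval 1 *
          ∫ x in Metric.ball a R, (1 + t • (fderiv ℝ r x - 1)).det ∂μ := by
        simp_rw [hexpand, ← integral_const_mul]
        exact integral_finsetSum _ fun t _ => (hint t).const_mul _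
    _ = ∑ t ∈ s, (Lagrange.basis s id t).eval 1 * μ.real (Metric.ball a R) :=
        Finset.sum_congr rfl fun t ht => by rw [hsmall (hs ht)]
    _ = μ.real (Metric.ball a R) := by rw [← Finset.sum_mul, hbasis, one_mul]

end Deformation

theorem not_contDiff_retraction_sphere [InnerProductSpace ℝ E] [FiniteDimensional ℝ E]
    {r : E → E} {a : E} {R : ℝ} (hR : 0 < R) (hr : ContDiff ℝ 1 r)
    (hmaps : MapsTo r (Metric.closedBall a R) (Metric.sphere a R)) :
    ¬ EqOn r id (Metric.sphere a R) := by
  intro hfix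
  borelize E
  have hdet (x : E) (hx : x ∈ Metric.ball a R) : (fderiv ℝ r x).det = 0 := by
    by_contra hne
    have hsurj : Function.Surjective (fderiv ℝ r x) :=
      ((LinearMap.equivOfDetNeZero _ hne).surjective)
    obtain ⟨v, hv⟩ := hsurj (r x - a)
    have hderiv := ((hr.differentiable one_ne_zero x).hasFDerivAt.sub_const a).norm_sq
    have hconst : (fun y => ‖r y - a‖ ^ 2) =ᶠ[𝓝 x] fun _ => R ^ 2 := by
      filter_upwards [Metric.isOpen_ball.mem_nhds hx] with y hy
      rw [mem_sphere_iff_norm.1 (hmaps (Metric.ball_subset_closedBall hy))]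
    have hzero := DFunLike.congr_fun
      (hderiv.unique ((hasFDerivAt_const _ x).congr_of_eventuallyEq hconst)) v
    have hnorm := mem_sphere_iff_norm.1 (hmaps (Metric.ball_subset_closedBall hx))
    have hself : inner ℝ (r x - a) (r x - a) = (0 : ℝ) := by
      simpa only [hv, inner_sub_left, nsmul_eq_mul, Nat.cast_ofNat, mul_eq_zero,
        OfNat.ofNat_ne_zero, false_or, zero_apply, smul_apply,
        ContinuousLinearMap.comp_apply, innerSL_apply_apply] using hzero
    rw [real_inner_self_eq_norm_sq, hnorm] at hself
    exact (pow_pos hR 2).ne' hself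
  have hint := setIntegral_det_fderiv_eq (volume : Measure E) hR hr
    (hmaps.mono_right Metric.sphere_subset_closedBall) hfix
  rw [setIntegral_congr_fun Metric.isOpen_ball.measurableSet hdet, integral_zero] at hint
  exact (ENNReal.toReal_pos (Metric.measure_ball_pos volume a hR).ne' measure_ball_lt_top.ne).ne
    hint

end Retraction

/-! ### Sets which are null-homotopic off a point -/

section NullHomotopy

variable {E : Type*} [NormedAddCommGroup E]

theorem exists_pos_le_norm_sub [ProperSpace E] {f : E → E} (hf : Continuous f)
    (hid : ∀ᶠ x in Bornology.cobounded E, f x = x) {a : E} (ha : ∀ x, f x ≠ a) :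
    ∃ η > 0, ∀ x, η ≤ ‖f x - a‖ := by
  obtain ⟨R, -, hRid⟩ := (Metric.hasBasis_cobounded_compl_closedBall a).eventually_iff.1 hid
  obtain ⟨x₀, -, hx₀⟩ := (isCompact_closedBall a (max R 1)).exists_isMinOn
    ⟨a, Metric.mem_closedBall_self (by positivity)⟩ (f := fun x => ‖f x - a‖) (by fun_prop)
  refine ⟨min ‖f x₀ - a‖ 1, lt_min (norm_pos_iff.2 (sub_ne_zero.2 (ha x₀))) one_pos, fun x => ?_⟩
  by_cases hx : x ∈ Metric.closedBall a (max R 1)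
  · exact (min_le_left _ _).trans (hx₀ hx)
  · rw [mem_closedBall_iff_norm, not_le, max_lt_iff] at hx
    rw [hRid (x := x) (by simpa [dist_eq_norm] using hx.1)]
    exact (min_le_right _ _).trans hx.2.le

variable [InnerProductSpace ℝ E] [FiniteDimensional ℝ E]

theorem exists_contDiff_ne_of_continuous_ne {f : E → E} (hf : Continuous f)
    (hid : ∀ᶠ x in Bornology.cobounded E, f x = x) {a : E} (ha : ∀ x, f x ≠ a) :
    ∃ F : E → E, ContDiff ℝ ∞ F ∧ (∀ᶠ x in Bornology.cobounded E, F x = x) ∧ ∀ x, F x ≠ a := by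
  obtain ⟨η, hη, hle⟩ := exists_pos_le_norm_sub hf hid ha
  obtain ⟨R, -, hRid⟩ :=
    (Metric.hasBasis_cobounded_compl_closedBall (0 : E)).eventually_iff.1 hid
  have hcs : HasCompactSupport fun x => f x - x :=
    HasCompactSupport.of_support_subset_isCompact (isCompact_closedBall 0 R) fun x hx =>
      not_not.1 fun h => hx (sub_eq_zero.2 (hRid h))
  obtain ⟨g, hg, hgf⟩ := ((hf.sub continuous_id).uniformContinuous_of_tendsto_cocompact
    hcs.is_zero_at_infty).exists_contDiff_dist_le hη
  let χ : ContDiffBump (0 : E) := ⟨max R 1, max R 1 + 1, by positivity, by linarith⟩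
  refine ⟨fun x => x + χ x • g x, contDiff_id.add (χ.contDiff.smul hg), ?_, fun x hx => ?_⟩
  · filter_upwards [Bornology.isBounded_def.1 χ.hasCompactSupport.isBounded] with x hx
    simp [image_eq_zero_of_notMem_tsupport hx]
  · have hnear : ‖χ x • g x - (f x - x)‖ < η := by
      have hgx : ‖g x - (f x - x)‖ < η := by simpa [dist_eq_norm] using hgf x
      by_cases hxR : x ∈ Metric.closedBall (0 : E) (max R 1)
      · rwa [χ.one_of_mem_closedBall hxR, one_smul]
      · rw [hRid fun h => hxR (Metric.closedBall_subset_closedBall (le_max_left _ _) h), sub_self,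
          sub_zero] at hgx ⊢
        rw [norm_smul, Real.norm_of_nonneg χ.nonneg]
        exact (mul_le_of_le_one_left (norm_nonneg _) χ.le_one).trans_lt hgx
    refine (hle x).not_gt ?_
    rwa [← hx, ← norm_neg, show -(f x - (x + χ x • g x)) = χ x • g x - (f x - x) by abel]

/-- Radial projection from a missed value `a` would turn `f` into a retraction of a large ball. -/
theorem surjective_of_continuous_of_eventually_eq_self {f : E → E} (hf : Continuous f)
    (hid : ∀ᶠ x in Bornology.cobounded E, f x = x) : Function.Surjective f := by
  intro a
  by_contra! ha
  obtain ⟨F, hF, hFid, hFa⟩ := exists_contDiff_ne_of_continuous_ne hf hid ha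
  obtain ⟨R, -, hRid⟩ := (Metric.hasBasis_cobounded_compl_ball a).eventually_iff.1 hFid
  have hne (x : E) : F x - a ≠ 0 := sub_ne_zero.2 (hFa x)
  have hR : 0 < max R 1 := by positivity
  let r : E → E := fun x => a + (max R 1 * ‖F x - a‖⁻¹) • (F x - a)
  have hr : ContDiff ℝ 1 r := by
    have hFa' : ContDiff ℝ 1 fun x => F x - a := (hF.of_le (by simp)).sub contDiff_const
    exact contDiff_const.add ((contDiff_const.mul ((hFa'.norm ℝ hne).inv
      fun x => norm_ne_zero_iff.2 (hne x))).smul hFa')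
  have hsphere (x : E) : r x ∈ Metric.sphere a (max R 1) := by
    simp [r, norm_smul, hne, abs_of_pos hR]
  refine not_contDiff_retraction_sphere hR hr (fun x _ => hsphere x) fun x hx => ?_
  have hx' : ‖x - a‖ = max R 1 := mem_sphere_iff_norm.1 hx
  have hFx : F x = x := hRid (by simp [dist_eq_norm, hx'])
  simp [r, hFx, hx', hR.ne']

theorem exists_extension_ne_of_nullhomotopic {X : Type*} [MetricSpace X] {K : Set X}
    (hK : IsClosed K) {s : Set E} {f : C(K, s)} (hf : f.Nullhomotopic) {a : E} (ha : a ∉ s) :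
    ∃ F : C(X, E), (∀ x : K, F x = f x) ∧ ∀ x, F x ≠ a := by
  obtain ⟨c, ⟨H⟩⟩ := hf
  have : TietzeExtension E := .of_tvs ℝ
  have hemb : IsClosedEmbedding (Prod.map id Subtype.val : unitInterval × K → unitInterval × X) :=
    IsClosedEmbedding.id.prodMap hK.isClosedEmbedding_subtypeVal
  obtain ⟨G, hG⟩ := ContinuousMap.exists_extension hemb
    (⟨fun z => (H z : E), by fun_prop⟩ : C(unitInterval × K, E))
  have hGH (t : unitInterval) (x : K) : G (t, x) = H (t, x) := DFunLike.congr_fun hG (t, x)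
  let G' : unitInterval × X → E := fun z => G z + (z.1 : ℝ) • (c - G (1, z.2))
  have hG' : Continuous G' := by fun_prop
  have hG'K (t : unitInterval) (x : K) : G' (t, x) = H (t, x) := by simp [G', hGH]
  have hG'1 (x : X) : G' (1, x) = c := by simp [G']
  have hZ : IsClosed (Prod.snd '' (G' ⁻¹' {a})) :=
    isClosedMap_snd_of_compactSpace _ (isClosed_singleton.preimage hG')
  have hdisj : Disjoint K (Prod.snd '' (G' ⁻¹' {a})) := by
    rw [Set.disjoint_left]
    rintro x hx ⟨⟨t, y⟩, hy : G' (t, y) = a, rfl⟩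
    exact ha (hy ▸ hG'K t ⟨y, hx⟩ ▸ (H (t, ⟨y, hx⟩)).2)
  obtain ⟨φ, hφ0, hφ1, hφ⟩ := exists_continuous_zero_one_of_isClosed hK hZ hdisj
  refine ⟨⟨fun x => G' (⟨φ x, hφ x⟩, x), hG'.comp (by fun_prop)⟩, fun x => ?_, fun x hx => ?_⟩
  · have h0 : (⟨φ x, hφ x⟩ : unitInterval) = 0 := Subtype.ext (hφ0 x.2)
    simp [h0, hG'K]
  · have h1 : (⟨φ x, hφ x⟩ : unitInterval) = 1 := Subtype.ext (hφ1 ⟨_, hx, rfl⟩)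
    rw [ContinuousMap.coe_mk, h1, hG'1] at hx
    exact ha (hx ▸ c.2)

theorem frontier_connectedComponentIn_compl_subset {X : Type*} [TopologicalSpace X]
    [LocallyConnectedSpace X] {K : Set X} (hK : IsClosed K) (a : X) :
    frontier (connectedComponentIn Kᶜ a) ⊆ K := by
  intro y hy
  by_contra hyK
  have hopen (z : X) : IsOpen (connectedComponentIn Kᶜ z) := hK.isOpen_compl.connectedComponentIn
  obtain ⟨z, hzy, hza⟩ := mem_closure_iff.1 (frontier_subset_closure hy) _ (hopen y)
    (mem_connectedComponentIn hyK)
  have heq : connectedComponentIn Kᶜ a = connectedComponentIn Kᶜ y :=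
    (connectedComponentIn_eq hza).trans (connectedComponentIn_eq hzy).symm
  rw [(hopen a).frontier_eq] at hy
  exact hy.2 (heq ▸ mem_connectedComponentIn hyK)

theorem not_isBounded_connectedComponentIn_of_nullhomotopic {K s : Set E} (hK : IsClosed K)
    (hKs : K ⊆ s) (hnull : (ContinuousMap.inclusion hKs).Nullhomotopic) {a : E} (ha : a ∉ s) :
    ¬ Bornology.IsBounded (connectedComponentIn Kᶜ a) := by
  classical
  intro hbdd
  obtain ⟨F, hFK, hFa⟩ := exists_extension_ne_of_nullhomotopic hK hnull ha
  have hcont : Continuous fun x => if x ∈ connectedComponentIn Kᶜ a then F x else x :=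
    Continuous.if
      (fun x hx => hFK ⟨x, frontier_connectedComponentIn_compl_subset hK a hx⟩) F.continuous
      continuous_id
  obtain ⟨x, hx⟩ := surjective_of_continuous_of_eventually_eq_self hcont
    (mem_of_superset (Bornology.isBounded_def.1 hbdd) fun x hx => if_neg hx) a
  beta_reduce at hx
  split_ifs at hx with hxa
  · exact hFa x hx
  · exact hxa (hx.symm ▸ mem_connectedComponentIn fun haK => ha (hKs haK))

end NullHomotopy

section UnboundedComponent

variable {E : Type*} [NormedAddCommGroup E] [NormedSpace ℝ E]

theorem isPreconnected_compl_closedBall (hE : 1 < Module.rank ℝ E) (a : E) {R : ℝ} (hR : 0 ≤ R) :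
    IsPreconnected (Metric.closedBall a R)ᶜ := by
  have himage := ((isPreconnected_Ioi (a := R)).prod (isPreconnected_sphere hE 0 1)).image
    (fun z : ℝ × E => a + z.1 • z.2) (by fun_prop)
  convert himage using 1
  ext x
  constructor
  · intro hx
    have hx' : R < ‖x - a‖ := by simpa [dist_eq_norm] using hx
    have hne : ‖x - a‖ ≠ 0 := (hR.trans_lt hx').ne'
    exact ⟨(‖x - a‖, ‖x - a‖⁻¹ • (x - a)), ⟨hx', by simp [norm_smul, hne]⟩,
      by simp [smul_smul, hne]⟩
  · rintro ⟨⟨t, y⟩, ⟨ht : R < t, hy⟩, rfl⟩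
    rw [mem_sphere_zero_iff_norm] at hy
    simpa [norm_smul, hy] using ht.trans_le (le_abs_self t)

theorem connectedComponentIn_compl_eq_of_not_isBounded (hE : 1 < Module.rank ℝ E) {K : Set E}
    (hK : Bornology.IsBounded K) {a b : E}
    (ha : ¬ Bornology.IsBounded (connectedComponentIn Kᶜ a))
    (hb : ¬ Bornology.IsBounded (connectedComponentIn Kᶜ b)) :
    connectedComponentIn Kᶜ a = connectedComponentIn Kᶜ b := by
  obtain ⟨R, hR, hKR⟩ := hK.subset_closedBall_lt 0 0
  have hmeet {c : E} (hc : ¬ Bornology.IsBounded (connectedComponentIn Kᶜ c)) :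
      ∃ z ∈ connectedComponentIn Kᶜ c, z ∉ Metric.closedBall (0 : E) R := by
    by_contra! h
    exact hc (Metric.isBounded_closedBall.subset h)
  obtain ⟨z, hz, hzR⟩ := hmeet ha
  obtain ⟨w, hw, hwR⟩ := hmeet hb
  have hwz : w ∈ connectedComponentIn Kᶜ z :=
    (isPreconnected_compl_closedBall hE 0 hR.le).subset_connectedComponentIn hzR
      (compl_subset_compl.2 hKR) hwR
  rw [connectedComponentIn_eq hz, connectedComponentIn_eq hw, connectedComponentIn_eq hwz]

end UnboundedComponent

theorem connectedComponentIn_compl_eq_of_nullhomotopic {E : Type*} [NormedAddCommGroup E]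
    [InnerProductSpace ℝ E] [FiniteDimensional ℝ E] (hE : 1 < Module.rank ℝ E) {K s : Set E}
    (hK : IsCompact K) (hKs : K ⊆ s) (hnull : (ContinuousMap.inclusion hKs).Nullhomotopic)
    {a b : E} (ha : a ∉ s) (hb : b ∉ s) :
    connectedComponentIn Kᶜ a = connectedComponentIn Kᶜ b :=
  connectedComponentIn_compl_eq_of_not_isBounded hE hK.isBounded
    (not_isBounded_connectedComponentIn_of_nullhomotopic hK.isClosed hKs hnull ha)
    (not_isBounded_connectedComponentIn_of_nullhomotopic hK.isClosed hKs hnull hb)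

/-! ### The flux of a gauge bridge -/

theorem integrable_restrict_prod_of_isCompact {X Y F : Type*} [TopologicalSpace X]
    [TopologicalSpace Y] [SecondCountableTopologyEither X Y] [NormedAddCommGroup F]
    [MeasurableSpace X] [OpensMeasurableSpace X] [T2Space X]
    [MeasurableSpace Y] [OpensMeasurableSpace Y] [T2Space Y]
    {μ : Measure X} [SFinite μ] [IsFiniteMeasureOnCompacts μ]
    {ν : Measure Y} [SFinite ν] [IsFiniteMeasureOnCompacts ν]
    {f : X × Y → F} {K : Set X} {s : Set Y} (hK : IsCompact K) (hs : IsCompact s)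
    (hf : ContinuousOn f (K ×ˢ univ)) (h0 : ∀ x ∈ K, ∀ y ∉ s, f (x, y) = 0) :
    Integrable f ((μ.restrict K).prod ν) := by
  have hint : IntegrableOn f (K ×ˢ univ) (μ.prod ν) :=
    ((hf.mono (prod_mono_right (subset_univ s))).integrableOn_compact
      (hK.prod hs)).of_forall_sdiff_eq_zero (hK.measurableSet.prod MeasurableSet.univ)
      fun z hz => h0 _ hz.1.1 _ fun hzs => hz.2 ⟨hz.1.1, hzs⟩
  rwa [IntegrableOn, ← Measure.prod_restrict, Measure.restrict_univ] at hint

theorem inner_grad (S : ScalarTest) (x v : E3) : inner ℝ v (grad S x) = fderiv ℝ S x v := by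
  change inner ℝ v (gradient S x) = _
  rw [real_inner_comm, gradient, InnerProductSpace.toDual_symm_apply]

namespace BridgeData

variable {x₁ x₂ : E3} {q : ℝ} (D : BridgeData x₁ x₂ q)

/-- The contribution of the parameter value `u` to the pairing of the bridge with `g`. -/
def flux (g : VectorTest) (u : ℝ) : ℝ :=
  ∫ y, D.profile y * inner ℝ (D.velocityAt y u) (g (D.pathAt y u))

theorem continuousOn_pathAt :
    ContinuousOn (fun z : ℝ × E3 => D.pathAt z.2 z.1) (Icc 0 1 ×ˢ univ) :=
  (D.smooth.continuousOn.comp continuousOn_fst fun _ hz => hz.1).add (by fun_prop)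

theorem continuousOn_velocityAt :
    ContinuousOn (fun z : ℝ × E3 => D.velocityAt z.2 z.1) (Icc 0 1 ×ˢ univ) :=
  (D.continuousOn_derivWithin.comp continuousOn_fst fun _ hz => hz.1).add (by fun_prop)

theorem continuousOn_inner_velocityAt (g : VectorTest) :
    ContinuousOn (fun z : ℝ × E3 => inner ℝ (D.velocityAt z.2 z.1) (g (D.pathAt z.2 z.1)))
      (Icc 0 1 ×ˢ univ) :=
  D.continuousOn_velocityAt.inner (g.continuous.comp_continuousOn D.continuousOn_pathAt)

theorem integrable_flux_integrand (g : VectorTest) {a b : ℝ} (hab : Icc a b ⊆ Icc 0 1) :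
    Integrable (fun z : ℝ × E3 =>
      D.profile z.2 * inner ℝ (D.velocityAt z.2 z.1) (g (D.pathAt z.2 z.1)))
      ((volume.restrict (Icc a b)).prod volume) :=
  integrable_restrict_prod_of_isCompact isCompact_Icc D.profile.hasCompactSupport
    ((D.profile.continuous.comp continuous_snd).continuousOn.mul
      ((D.continuousOn_inner_velocityAt g).mono (prod_mono_left hab)))
    fun u _ y hy => by simp [image_eq_zero_of_notMem_tsupport hy]

theorem integrableOn_flux (g : VectorTest) : IntegrableOn (D.flux g) (Icc 0 1) :=
  (D.integrable_flux_integrand g subset_rfl).integral_prod_left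

theorem continuousOn_slice {ε : ℝ} (hε : 0 < ε) :
    ContinuousOn (fun z : ℝ × E3 => D.slice z.1 z.2) (Icc ε (1 - ε) ×ˢ univ) := by
  have hsub : Icc ε (1 - ε) ⊆ Icc 0 1 := Icc_subset_Icc hε.le (by linarith)
  have hk : ContinuousOn (fun z : ℝ × E3 => (z.1 * (1 - z.1))⁻¹) (Icc ε (1 - ε) ×ˢ univ) :=
    ContinuousOn.inv₀ (by fun_prop) fun z hz =>
      (mul_pos (hε.trans_le hz.1.1) (by linarith [hz.1.2])).ne'
  have hparam : ContinuousOn (fun z : ℝ × E3 => (z.1 * (1 - z.1))⁻¹ • (z.2 - D.path z.1))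
      (Icc ε (1 - ε) ×ˢ univ) :=
    hk.smul (continuousOn_snd.sub
      (D.smooth.continuousOn.comp continuousOn_fst fun z hz => hsub hz.1))
  exact ((hk.pow 3).mul (D.profile.continuous.comp_continuousOn hparam)).smul
    (D.continuousOn_velocityAt.comp (continuousOn_fst.prodMk hparam)
      fun z hz => ⟨hsub hz.1, mem_univ _⟩)

theorem cutoff_apply {ε : ℝ} (hε : 0 < ε) (x : E3) :
    D.cutoff ε x = ∫ u in Icc ε (1 - ε), D.slice u x := by
  rw [cutoff, dif_pos hε]
  rfl

theorem pairing_cutoff {ε : ℝ} (hε : 0 < ε) (g : VectorTest) :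
    pairing (D.cutoff ε) g = ∫ u in Icc ε (1 - ε), D.flux g u := by
  have hslice := D.continuousOn_slice hε
  have hint : Integrable (fun z : ℝ × E3 => inner ℝ (D.slice z.1 z.2) (g z.2))
      ((volume.restrict (Icc ε (1 - ε))).prod volume) :=
    integrable_restrict_prod_of_isCompact isCompact_Icc g.hasCompactSupport
      (hslice.inner (g.continuous.comp continuous_snd).continuousOn)
      fun u _ x hx => by simp [image_eq_zero_of_notMem_tsupport hx]
  calc pairing (D.cutoff ε) g
      = ∫ x, ∫ u in Icc ε (1 - ε), inner ℝ (D.slice u x) (g x) := by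
        refine integral_congr_ae (Eventually.of_forall fun x => ?_)
        have hslice_x : IntegrableOn (fun u => D.slice u x) (Icc ε (1 - ε)) :=
          (hslice.comp (f := fun u : ℝ => (u, x)) (by fun_prop)
            fun u hu => ⟨hu, mem_univ _⟩).integrableOn_compact isCompact_Icc
        simp only [D.cutoff_apply hε]
        rw [real_inner_comm, ← integral_inner hslice_x]
        simp only [real_inner_comm]
    _ = ∫ u in Icc ε (1 - ε), ∫ x, inner ℝ (D.slice u x) (g x) :=
        (integral_integral_swap hint).symm
    _ = ∫ u in Icc ε (1 - ε), D.flux g u :=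
        setIntegral_congr_fun measurableSet_Icc fun u hu =>
          D.integral_inner_slice ⟨hε.trans_le hu.1, by linarith [hu.2]⟩ g

theorem tendsto_pairing_cutoff (g : VectorTest) :
    Tendsto (fun ε => pairing (D.cutoff ε) g) (𝓝[>] 0) (𝓝 (∫ u in Ioo 0 1, D.flux g u)) := by
  have hleft : Tendsto (fun ε : ℝ => ε) (𝓝[>] 0) (𝓝 0) := tendsto_id.mono_left nhdsWithin_le_nhds
  have hright : Tendsto (fun ε : ℝ => 1 - ε) (𝓝[>] 0) (𝓝 1) := by simpa using hleft.const_sub 1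
  refine ((aecover_Ioo_of_Icc (μ := (volume : Measure ℝ)) hleft
    hright).integral_tendsto_of_countably_generated
      ((D.integrableOn_flux g).mono_set Ioo_subset_Icc_self)).congr' ?_
  filter_upwards [self_mem_nhdsWithin] with ε (hε : 0 < ε)
  rw [D.pairing_cutoff hε, Measure.restrict_restrict measurableSet_Icc, inter_eq_left.2]
  exact fun u hu => ⟨hε.trans_le hu.1, by linarith [hu.2]⟩

/-- The limit of the functionals `g ↦ ⟨b_ε, g⟩`. -/
def fluxFunctional : VectorTest →+ ℝ :=
  AddMonoidHom.mk' (fun g => ∫ u in Ioo 0 1, D.flux g u) fun g g' => by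
    refine tendsto_nhds_unique (D.tendsto_pairing_cutoff (g + g')) ?_
    simp only [pairing_add_right]
    exact (D.tendsto_pairing_cutoff g).add (D.tendsto_pairing_cutoff g')

theorem tendsto_pairing_fluxFunctional (g : VectorTest) :
    Tendsto (fun ε => pairing (D.cutoff ε) g) (𝓝[>] 0) (𝓝 (D.fluxFunctional g)) :=
  D.tendsto_pairing_cutoff g

theorem hasDerivAt_pathAt (y : E3) {u : ℝ} (hu : u ∈ Ioo (0 : ℝ) 1) :
    HasDerivAt (D.pathAt y) (D.velocityAt y u) u := by
  have hpath : HasDerivAt D.path (derivWithin D.path (Icc 0 1) u) u :=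
    (D.smooth.differentiableOn (by simp) u
      (Ioo_subset_Icc_self hu)).hasDerivWithinAt.hasDerivAt (Icc_mem_nhds hu.1 hu.2)
  have hwidth : HasDerivAt (fun u : ℝ => u * (1 - u)) (1 - 2 * u) u :=
    ((hasDerivAt_id' u).mul ((hasDerivAt_id' u).const_sub 1)).congr_deriv (by ring)
  exact hpath.add (hwidth.smul_const y)

theorem integral_inner_velocityAt_grad {ε : ℝ} (hε : 0 < ε) (hε' : ε ≤ 1 / 2) (S : ScalarTest)
    (y : E3) :
    ∫ u in Icc ε (1 - ε), inner ℝ (D.velocityAt y u) (grad S (D.pathAt y u)) =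
      S (D.pathAt y (1 - ε)) - S (D.pathAt y ε) := by
  have hle : ε ≤ 1 - ε := by linarith
  have hsub : Icc ε (1 - ε) ⊆ Ioo 0 1 := fun u hu => ⟨hε.trans_le hu.1, by linarith [hu.2]⟩
  have hcont : ContinuousOn (fun u => inner ℝ (D.velocityAt y u) (grad S (D.pathAt y u)))
      (Icc ε (1 - ε)) :=
    (D.continuousOn_inner_velocityAt (grad S)).comp (f := fun u : ℝ => (u, y)) (by fun_prop)
      fun u hu => ⟨Ioo_subset_Icc_self (hsub hu), mem_univ _⟩
  rw [integral_Icc_eq_integral_Ioc, ← intervalIntegral.integral_of_le hle]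
  refine intervalIntegral.integral_eq_sub_of_hasDerivAt (f := fun u => S (D.pathAt y u))
    (fun u hu => ?_) (hcont.intervalIntegrable_of_Icc hle)
  rw [uIcc_of_le hle] at hu
  rw [inner_grad]
  exact (S.contDiff.differentiable (by simp) _).hasFDerivAt.comp_hasDerivAt u
    (D.hasDerivAt_pathAt y (hsub hu))

theorem pairing_cutoff_grad {ε : ℝ} (hε : 0 < ε) (hε' : ε ≤ 1 / 2) (S : ScalarTest) :
    pairing (D.cutoff ε) (grad S) =
      ∫ y, D.profile y * (S (D.pathAt y (1 - ε)) - S (D.pathAt y ε)) := by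
  have hsub : Icc ε (1 - ε) ⊆ Icc 0 1 := Icc_subset_Icc hε.le (by linarith)
  rw [D.pairing_cutoff hε]
  unfold flux
  rw [integral_integral_swap (D.integrable_flux_integrand (grad S) hsub)]
  simp only [integral_const_mul, D.integral_inner_velocityAt_grad hε hε']

theorem tendsto_path_source : Tendsto D.path (𝓝[>] 0) (𝓝 x₁) := by
  have hcont := (D.smooth.continuousOn 0 ⟨le_rfl, zero_le_one⟩).tendsto
  rw [D.source] at hcont
  refine hcont.mono_left ?_
  rw [← nhdsWithin_Ioo_eq_nhdsGT (zero_lt_one' ℝ)]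
  exact nhdsWithin_mono _ Ioo_subset_Icc_self

theorem tendsto_width : Tendsto (fun u : ℝ => |u * (1 - u)| * D.R) (𝓝[>] 0) (𝓝 0) := by
  have hcont : Continuous fun u : ℝ => |u * (1 - u)| * D.R := by fun_prop
  simpa using hcont.continuousAt.tendsto.mono_left (nhdsWithin_le_nhds (a := (0 : ℝ)))

theorem eventually_pathAt_source {N : Set E3} (hN : N ∈ 𝓝 x₁) :
    ∀ᶠ u in 𝓝[>] (0 : ℝ), ∀ y ∈ tsupport D.profile, D.pathAt y u ∈ N := by
  obtain ⟨r, hr, hN⟩ := Metric.mem_nhds_iff.1 hN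
  filter_upwards [D.tendsto_path_source (Metric.ball_mem_nhds _ (half_pos hr)),
    D.tendsto_width.eventually_lt_const (half_pos hr)] with u hpath hwidth y hy
  refine hN ?_
  have hyR : ‖y‖ < D.R := mem_ball_zero_iff.1 (D.profile_support hy)
  have hshift : ‖(u * (1 - u)) • y‖ ≤ |u * (1 - u)| * D.R := by
    rw [norm_smul, Real.norm_eq_abs]
    gcongr
  have hpath' : ‖D.path u - x₁‖ < r / 2 := mem_ball_iff_norm.1 hpath
  rw [mem_ball_iff_norm, pathAt, add_sub_right_comm]
  exact (norm_add_le _ _).trans_lt (by linarith)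

/-- The bridge traversed backwards, from `x₂` to `x₁`. -/
def reverse : BridgeData x₂ x₁ q where
  path u := D.path (1 - u)
  smooth := D.smooth.comp (contDiff_const.sub contDiff_id).contDiffOn
    fun u hu => ⟨sub_nonneg.2 hu.2, sub_le_self _ hu.1⟩
  simple u hu v hv h := sub_right_injective (D.simple (⟨sub_nonneg.2 hu.2, sub_le_self _ hu.1⟩)
    (⟨sub_nonneg.2 hv.2, sub_le_self _ hv.1⟩) h)
  source := by simp [D.target]
  target := by simp [D.source]
  R := D.R
  R_pos := D.R_pos
  away_left u hu := by
    have := D.away_right (1 - u) ⟨sub_pos.2 hu.2, sub_lt_self _ hu.1⟩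
    rwa [sub_sub_cancel, mul_comm (1 - u)⁻¹] at this
  away_right u hu := by
    have := D.away_left (1 - u) ⟨sub_pos.2 hu.2, sub_lt_self _ hu.1⟩
    rwa [sub_sub_cancel, mul_comm (1 - u)⁻¹] at this
  profile := D.profile
  profile_support := D.profile_support
  profile_integral := D.profile_integral

theorem eventually_pathAt_target {N : Set E3} (hN : N ∈ 𝓝 x₂) :
    ∀ᶠ u in 𝓝[>] (0 : ℝ), ∀ y ∈ tsupport D.profile, D.pathAt y (1 - u) ∈ N := by
  filter_upwards [D.reverse.eventually_pathAt_source hN] with u hu y hy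
  simpa [pathAt, reverse, mul_comm] using hu y hy

theorem eventually_pairing_cutoff_grad {S : ScalarTest} {c₁ c₂ : ℝ}
    (h₁ : ∀ᶠ x in 𝓝 x₁, S x = c₁) (h₂ : ∀ᶠ x in 𝓝 x₂, S x = c₂) :
    ∀ᶠ ε in 𝓝[>] (0 : ℝ), pairing (D.cutoff ε) (grad S) = q * (c₂ - c₁) := by
  filter_upwards [D.eventually_pathAt_source h₁, D.eventually_pathAt_target h₂,
    Ioo_mem_nhdsGT (one_half_pos (α := ℝ))] with ε hε₁ hε₂ hε
  rw [D.pairing_cutoff_grad hε.1 hε.2.le]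
  refine Eq.trans ?_ (congrArg (· * (c₂ - c₁)) D.profile_integral)
  rw [← integral_mul_const]
  refine integral_congr_ae (Eventually.of_forall fun y => ?_)
  by_cases hy : y ∈ tsupport D.profile
  · have hS₁ : S (D.pathAt y ε) = c₁ := hε₁ y hy
    have hS₂ : S (D.pathAt y (1 - ε)) = c₂ := hε₂ y hy
    simp only [hS₁, hS₂]
  · simp [image_eq_zero_of_notMem_tsupport hy]

theorem fluxFunctional_grad {S : ScalarTest} {c₁ c₂ : ℝ}
    (h₁ : ∀ᶠ x in 𝓝 x₁, S x = c₁) (h₂ : ∀ᶠ x in 𝓝 x₂, S x = c₂) :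
    D.fluxFunctional (grad S) = q * (c₂ - c₁) :=
  tendsto_nhds_unique (D.tendsto_pairing_fluxFunctional _)
    (tendsto_const_nhds.congr' <| (D.eventually_pairing_cutoff_grad h₁ h₂).mono fun _ h => h.symm)

theorem flux_eq_zero {K : Set E3} {g : VectorTest} (hg : tsupport g ⊆ K) {u : ℝ}
    (hu : ∀ y ∈ tsupport D.profile, D.pathAt y u ∉ K) : D.flux g u = 0 := by
  refine integral_eq_zero_of_ae (Eventually.of_forall fun y => ?_)
  by_cases hy : y ∈ tsupport D.profile
  · simp [image_eq_zero_of_notMem_tsupport fun h => hu y hy (hg h)]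
  · simp [image_eq_zero_of_notMem_tsupport hy]

theorem eventually_pairing_cutoff_eq {K : Set E3} (hK : IsClosed K) (h₁ : x₁ ∉ K) (h₂ : x₂ ∉ K) :
    ∀ᶠ ε in 𝓝[>] (0 : ℝ), ∀ g : VectorTest, tsupport g ⊆ K →
      pairing (D.cutoff ε) g = D.fluxFunctional g := by
  obtain ⟨ε₀, hε₀ : 0 < ε₀, hoff⟩ := mem_nhdsGT_iff_exists_Ioo_subset.1
    ((D.eventually_pathAt_source (hK.isOpen_compl.mem_nhds h₁)).and
      (D.eventually_pathAt_target (hK.isOpen_compl.mem_nhds h₂)))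
  filter_upwards [Ioo_mem_nhdsGT hε₀] with ε hε g hg
  rw [D.pairing_cutoff hε.1]
  refine (setIntegral_eq_of_subset_of_forall_sdiff_eq_zero measurableSet_Ioo
    (fun u hu => ⟨hε.1.trans_le hu.1, by linarith [hu.2, hε.1]⟩)
    fun u hu => D.flux_eq_zero hg fun y hy => ?_).symm
  rcases lt_or_ge u ε with huε | huε
  · exact (hoff ⟨hu.1.1, huε.trans hε.2⟩).1 y hy
  · have huε' : 1 - ε < u := not_le.1 fun h => hu.2 ⟨huε, h⟩
    simpa using (hoff (a := 1 - u) ⟨by linarith [hu.1.2], by linarith [hε.2]⟩).2 y hy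

end BridgeData

/-! ### Transport of charge densities -/

section Translates

open scoped Pointwise

theorem hasLineDerivAt_setIntegral_translate {E F : Type*} [AddCommGroup E] [Module ℝ E]
    [TopologicalSpace E] [IsTopologicalAddGroup E] [ContinuousSMul ℝ E] [NormedAddCommGroup F]
    [NormedSpace ℝ F] [CompleteSpace F] {f : E → F} (hf : Continuous f) (x v : E) :
    HasLineDerivAt ℝ (fun x => ∫ t in Icc (0 : ℝ) 1, f (x - t • v)) (f x - f (x - v)) x v := by
  have hcont : Continuous fun t : ℝ => f (x - t • v) := hf.comp (by fun_prop)
  have hderiv (b : ℝ) :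
      HasDerivAt (fun b => ∫ t in (0 : ℝ)..b, f (x - t • v)) (f (x - b • v)) b :=
    intervalIntegral.integral_hasDerivAt_right (hcont.intervalIntegrable _ _)
      hcont.stronglyMeasurable.stronglyMeasurableAtFilter hcont.continuousAt
  have hshift (h : ℝ) : ∫ t in Icc (0 : ℝ) 1, f (x + h • v - t • v) =
      (∫ t in (0 : ℝ)..(1 - h), f (x - t • v)) - ∫ t in (0 : ℝ)..(0 - h), f (x - t • v) := by
    rw [intervalIntegral.integral_interval_sub_left (hcont.intervalIntegrable _ _)
      (hcont.intervalIntegrable _ _), integral_Icc_eq_integral_Ioc,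
      ← intervalIntegral.integral_of_le zero_le_one,
      ← intervalIntegral.integral_comp_sub_right (fun t => f (x - t • v)) h]
    simp only [sub_smul, sub_sub_eq_add_sub, add_sub_right_comm]
  have hupper := (hderiv (1 - 0)).scomp (0 : ℝ) ((hasDerivAt_id' (0 : ℝ)).const_sub 1)
  have hlower := (hderiv (0 - 0)).scomp (0 : ℝ) ((hasDerivAt_id' (0 : ℝ)).const_sub 0)
  unfold HasLineDerivAt
  simp only [hshift]
  refine (hupper.sub hlower).congr_deriv ?_
  simp only [sub_zero, one_smul, zero_smul, neg_smul]
  abel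

theorem support_setIntegral_translate_subset {E F : Type*} [AddCommGroup E] [Module ℝ E]
    [TopologicalSpace E] [NormedAddCommGroup F] [NormedSpace ℝ F] (f : E → F) (v : E) :
    Function.support (fun x => ∫ t in Icc (0 : ℝ) 1, f (x - t • v)) ⊆
      segment ℝ 0 v + tsupport f := by
  intro x hx
  by_contra hnot
  refine hx (setIntegral_eq_zero_of_forall_eq_zero fun t ht => ?_)
  by_contra h
  refine hnot ⟨t • v, ?_, x - t • v, subset_tsupport _ h, add_sub_cancel _ _⟩
  rw [segment_eq_image']
  exact ⟨t, ht, by simp⟩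

theorem isCompact_segment_add_tsupport (ρ : ScalarTest) (v : E3) :
    IsCompact (segment ℝ 0 v + tsupport ρ) := by
  rw [← convexHull_pair]
  exact ((toFinite _).isCompact_convexHull ℝ).add ρ.hasCompactSupport

/-- The translate `x ↦ ρ(x - p)`, a charge density near `p` if `ρ` lives near `0`. -/
def translate (ρ : ScalarTest) (p : E3) : ScalarTest where
  toFun x := ρ (x - p)
  contDiff' := ρ.contDiff.comp (contDiff_id.sub contDiff_const)
  hasCompactSupport' := ρ.hasCompactSupport.comp_homeomorph (Homeomorph.subRight p)
  tsupport_subset' := fun _ _ => trivial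

theorem translate_apply (ρ : ScalarTest) (p x : E3) : translate ρ p x = ρ (x - p) := rfl

/-- The vector test function `x ↦ φ(x) v`. -/
def smulVector (φ : ScalarTest) (v : E3) : VectorTest where
  toFun x := φ x • v
  contDiff' := φ.contDiff.smul contDiff_const
  hasCompactSupport' := φ.hasCompactSupport.smul_right
  tsupport_subset' := fun _ _ => trivial

theorem smulVector_apply (φ : ScalarTest) (v x : E3) : smulVector φ v x = φ x • v := rfl

/-- The average of the translates of `ρ` by `t v`, `0 ≤ t ≤ 1`: the density of a field along `v`
with sources at the two ends. -/
def tube (ρ : ScalarTest) (v : E3) : ScalarTest where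
  toFun x := ∫ t in Icc (0 : ℝ) 1, ρ (x - t • v)
  contDiff' := contDiff_setIntegral_of_compact volume isCompact_Icc (fun t : ℝ => t • v)
    (by fun_prop) (fun z : E3 × E3 => ρ (z.2 - z.1))
    (ρ.contDiff.comp (contDiff_snd.sub contDiff_fst))
  hasCompactSupport' := HasCompactSupport.of_support_subset_isCompact
    (isCompact_segment_add_tsupport ρ v) (support_setIntegral_translate_subset ρ v)
  tsupport_subset' := fun _ _ => trivial

theorem tsupport_tube_subset (ρ : ScalarTest) (v : E3) :
    tsupport (tube ρ v) ⊆ segment ℝ 0 v + tsupport ρ :=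
  closure_minimal (support_setIntegral_translate_subset ρ v)
    (isCompact_segment_add_tsupport ρ v).isClosed

theorem fderiv_tube (ρ : ScalarTest) (v x : E3) :
    fderiv ℝ (tube ρ v) x v = ρ x - ρ (x - v) :=
  (((tube ρ v).contDiff.differentiable (by simp) x).hasFDerivAt.hasLineDerivAt v).unique
    (hasLineDerivAt_setIntegral_translate ρ.continuous x v)

theorem pairing_smulVector_grad (φ S : ScalarTest) (v : E3) :
    pairing (smulVector φ v) (grad S) = -∫ x, fderiv ℝ φ x v * S x := by
  have hφ : ContDiff ℝ ∞ (φ : E3 → ℝ) := φ.contDiff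
  have hS : ContDiff ℝ ∞ (S : E3 → ℝ) := S.contDiff
  have hφ' : Continuous (fun x => fderiv ℝ φ x v) :=
    (hφ.continuous_fderiv (by simp)).clm_apply continuous_const
  have hS' : Continuous (fun x => fderiv ℝ S x v) :=
    (hS.continuous_fderiv (by simp)).clm_apply continuous_const
  rw [← integral_mul_fderiv_eq_neg_fderiv_mul_of_integrable]
  · simp only [pairing, smulVector_apply, real_inner_smul_left, inner_grad]
  · exact (hφ'.mul hS.continuous).integrable_of_hasCompactSupport S.hasCompactSupport.mul_left
  · exact (hφ.continuous.mul hS').integrable_of_hasCompactSupport φ.hasCompactSupport.mul_right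
  · exact (hφ.continuous.mul hS.continuous).integrable_of_hasCompactSupport
      φ.hasCompactSupport.mul_right
  · exact fun x _ => hφ.differentiable (by simp) x
  · exact fun x _ => hS.differentiable (by simp) x

/-- A field supported near the segment from `p` to `p'`, whose divergence is the difference of the
charge densities `ρ(· - p)` and `ρ(· - p')`. -/
def segmentField (ρ : ScalarTest) (p p' : E3) : VectorTest :=
  smulVector (tube (translate ρ p) (p' - p)) (p' - p)

theorem integrable_mul_shift (ρ S : ScalarTest) (p : E3) :
    Integrable (fun x => ρ x * S (p + x)) :=
  (ρ.continuous.mul (S.continuous.comp (by fun_prop))).integrable_of_hasCompactSupport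
    ρ.hasCompactSupport.mul_right

theorem integrable_mul_shift_sub (ρ S : ScalarTest) (p p' : E3) :
    Integrable (fun x => ρ x * (S (p' + x) - S (p + x))) := by
  simp only [mul_sub]
  exact (integrable_mul_shift ρ S p').sub (integrable_mul_shift ρ S p)

theorem integral_translate_mul (ρ S : ScalarTest) (p : E3) :
    ∫ x, translate ρ p x * S x = ∫ x, ρ x * S (p + x) := by
  rw [← integral_add_left_eq_self _ p]
  simp only [translate_apply, add_sub_cancel_left]

theorem pairing_segmentField (ρ S : ScalarTest) (p p' : E3) :
    pairing (segmentField ρ p p') (grad S) = ∫ x, ρ x * (S (p' + x) - S (p + x)) := by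
  have hint (p : E3) : Integrable fun x => translate ρ p x * S x :=
    ((translate ρ p).continuous.mul S.continuous).integrable_of_hasCompactSupport
      S.hasCompactSupport.mul_left
  have hend (x : E3) : translate ρ p (x - (p' - p)) = translate ρ p' x := by
    rw [translate_apply, translate_apply, sub_sub, sub_add_cancel]
  rw [segmentField, pairing_smulVector_grad]
  simp only [fderiv_tube, hend, mul_sub, sub_mul]
  rw [integral_sub (hint p) (hint p'),
    integral_sub (integrable_mul_shift ρ S p') (integrable_mul_shift ρ S p),
    integral_translate_mul, integral_translate_mul, neg_sub]

theorem tsupport_segmentField_subset {ρ : ScalarTest} {a p p' : E3} {r : ℝ}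
    (hp : p ∈ Metric.ball a (r / 2)) (hp' : p' ∈ Metric.ball a (r / 2))
    (hρ : tsupport ρ ⊆ Metric.ball 0 (r / 2)) :
    tsupport (segmentField ρ p p') ⊆ Metric.ball a r := by
  refine ((tsupport_smul_subset_left _ _).trans (tsupport_tube_subset _ _)).trans ?_
  rintro _ ⟨w, hw, z, hz, rfl⟩
  rw [segment_eq_image'] at hw
  obtain ⟨t, ht, rfl⟩ := hw
  have hz' : ‖z - p‖ < r / 2 :=
    mem_ball_zero_iff.1 (hρ (tsupport_comp_subset_preimage ρ (continuous_sub_right p) hz))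
  have hw' : ‖p + t • (p' - p) - a‖ < r / 2 :=
    mem_ball_iff_norm.1 ((convex_ball a (r / 2)).add_smul_sub_mem hp hp' ht)
  rw [mem_ball_iff_norm]
  calc ‖0 + t • (p' - p - 0) + z - a‖ = ‖(p + t • (p' - p) - a) + (z - p)‖ := by
        congr 1; module
    _ ≤ ‖p + t • (p' - p) - a‖ + ‖z - p‖ := norm_add_le _ _
    _ < r := by linarith

end Translates

/-- The charge density `ρ` can be moved from `p` to `p'` inside `V`: its translates by `p` and `p'`
differ by the divergence of a field supported in `V`. The divergence is expressed by testing with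
gradients. -/
def HasTransport (V : Set E3) (ρ : ScalarTest) (p p' : E3) : Prop :=
  ∃ c : VectorTest, tsupport c ⊆ V ∧
    ∀ S : ScalarTest, pairing c (grad S) = ∫ x, ρ x * (S (p' + x) - S (p + x))

namespace HasTransport

variable {V : Set E3} {ρ : ScalarTest} {p p' p'' : E3}

theorem symm (h : HasTransport V ρ p p') : HasTransport V ρ p' p := by
  obtain ⟨c, hc, hS⟩ := h
  refine ⟨-c, (tsupport_neg (c : E3 → E3)).trans_subset hc, fun S => ?_⟩
  rw [pairing_neg_left, hS, ← integral_neg]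
  simp only [← mul_neg, neg_sub]

theorem trans (h : HasTransport V ρ p p') (h' : HasTransport V ρ p' p'') :
    HasTransport V ρ p p'' := by
  obtain ⟨c, hc, hS⟩ := h
  obtain ⟨c', hc', hS'⟩ := h'
  refine ⟨c + c', (tsupport_add (c : E3 → E3) c').trans (union_subset hc hc'), fun S => ?_⟩
  rw [pairing_add_left, hS, hS', ← integral_add (integrable_mul_shift_sub ρ S p p')
    (integrable_mul_shift_sub ρ S p' p'')]
  simp only [← mul_add, sub_add_sub_cancel']

end HasTransport

theorem hasTransport_of_ball_subset {V : Set E3} {ρ : ScalarTest} {a p p' : E3} {r : ℝ}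
    (hV : Metric.ball a r ⊆ V) (hρ : tsupport ρ ⊆ Metric.ball 0 (r / 2))
    (hp : p ∈ Metric.ball a (r / 2)) (hp' : p' ∈ Metric.ball a (r / 2)) :
    HasTransport V ρ p p' :=
  ⟨segmentField ρ p p', (tsupport_segmentField_subset hp hp' hρ).trans hV,
    fun S => pairing_segmentField ρ S p p'⟩

/-- All charge densities which are sufficiently concentrated near the origin can be moved from `p`
to `p'` inside `V`. -/
def Transportable (V : Set E3) (p p' : E3) : Prop :=
  ∃ δ > 0, ∀ ρ : ScalarTest, tsupport ρ ⊆ Metric.ball 0 δ → HasTransport V ρ p p'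

namespace Transportable

variable {V : Set E3} {p p' p'' : E3}

theorem symm (h : Transportable V p p') : Transportable V p' p := by
  obtain ⟨δ, hδ, h⟩ := h
  exact ⟨δ, hδ, fun ρ hρ => (h ρ hρ).symm⟩

theorem trans (h : Transportable V p p') (h' : Transportable V p' p'') :
    Transportable V p p'' := by
  obtain ⟨δ, hδ, h⟩ := h
  obtain ⟨δ', hδ', h'⟩ := h'
  exact ⟨min δ δ', lt_min hδ hδ', fun ρ hρ =>
    (h ρ (hρ.trans (Metric.ball_subset_ball (min_le_left _ _)))).trans
      (h' ρ (hρ.trans (Metric.ball_subset_ball (min_le_right _ _))))⟩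

end Transportable

theorem transportable_of_isPreconnected {V C : Set E3} (hV : IsOpen V) (hCV : C ⊆ V)
    (hC : IsPreconnected C) {p p' : E3} (hp : p ∈ C) (hp' : p' ∈ C) : Transportable V p p' := by
  refine hC.induction₂ (Transportable V) (fun a ha => ?_) (fun _ _ _ _ _ _ => .trans)
    (fun _ _ _ _ => .symm) hp hp'
  obtain ⟨r, hr, hball⟩ := Metric.isOpen_iff.1 hV a (hCV ha)
  filter_upwards [nhdsWithin_le_nhds (Metric.ball_mem_nhds a (half_pos hr))] with b hb
  exact ⟨r / 2, half_pos hr, fun ρ hρ =>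
    hasTransport_of_ball_subset hball hρ (Metric.mem_ball_self (half_pos hr)) hb⟩

/-! ### The divergence theorem for singular cubes -/

theorem toLp_preimage_image {ι : Type*} (F : (ι → ℝ) → EuclideanSpace ℝ ι) (s : Set (ι → ℝ)) :
    WithLp.toLp 2 ⁻¹' (F '' s) = (WithLp.ofLp ∘ F) '' s := by
  rw [image_comp]
  exact ((WithLp.equiv 2 (ι → ℝ)).image_eq_preimage_symm _).symm

section EuclideanImage

variable {ι : Type*} [Fintype ι] {F : (ι → ℝ) → EuclideanSpace ℝ ι} {s : Set (ι → ℝ)}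

theorem volume_image_euclidean_eq_zero (hF : DifferentiableOn ℝ F s) (hs : volume s = 0) :
    volume (F '' s) = 0 := by
  rw [← (PiLp.volume_preserving_toLp ι).measure_preimage_emb
    (MeasurableEquiv.toLp 2 (ι → ℝ)).measurableEmbedding, toLp_preimage_image]
  exact addHaar_image_eq_zero_of_differentiableOn_of_addHaar_eq_zero volume
    ((EuclideanSpace.equiv ι ℝ).differentiable.comp_differentiableOn hF) hs

theorem setIntegral_image_euclidean {G : Type*} [NormedAddCommGroup G] [NormedSpace ℝ G]
    {F' : (ι → ℝ) → (ι → ℝ) →L[ℝ] EuclideanSpace ℝ ι} (hs : MeasurableSet s)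
    (hF : ∀ u ∈ s, HasFDerivWithinAt F (F' u) s u) (hinj : InjOn F s)
    (h : EuclideanSpace ℝ ι → G) :
    ∫ y in F '' s, h y =
      ∫ u in s, |((EuclideanSpace.equiv ι ℝ : _ →L[ℝ] _) ∘L F' u).det| • h (F u) := by
  rw [← (PiLp.volume_preserving_toLp ι).setIntegral_preimage_emb
    (MeasurableEquiv.toLp 2 (ι → ℝ)).measurableEmbedding, toLp_preimage_image]
  exact integral_image_eq_integral_abs_det_fderiv_smul volume hs
    (fun u hu => (EuclideanSpace.equiv ι ℝ).hasFDerivAt.comp_hasFDerivWithinAt u (hF u hu))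
    ((WithLp.ofLp_injective 2).comp_injOn hinj) fun x => h (WithLp.toLp 2 x)

end EuclideanImage

theorem inner_cross (w a b : E3) : inner ℝ w (cross a b) =
    w 0 * (a 1 * b 2 - a 2 * b 1) + w 1 * (a 2 * b 0 - a 0 * b 2) +
      w 2 * (a 0 * b 1 - a 1 * b 0) := by
  simp only [PiLp.inner_apply, Fin.sum_univ_three, cross, cross_apply, RCLike.inner_apply,
    conj_trivial, Matrix.cons_val]
  ring

theorem det_equiv_comp (A : (Fin 3 → ℝ) →L[ℝ] E3) :
    ((EuclideanSpace.equiv (Fin 3) ℝ : _ →L[ℝ] _) ∘L A).det =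
      inner ℝ (A (Pi.single 0 1)) (cross (A (Pi.single 1 1)) (A (Pi.single 2 1))) := by
  rw [ContinuousLinearMap.det, ← LinearMap.det_toMatrix', Matrix.det_fin_three, inner_cross]
  simp only [LinearMap.toMatrix'_apply, ContinuousLinearMap.coe_coe,
    ContinuousLinearMap.comp_apply, ContinuousLinearEquiv.coe_coe, PiLp.continuousLinearEquiv_apply]
  ring

/-- The triple product `(a, b) ↦ w · (a × b)` as a continuous bilinear map. -/
def tripleProduct (w : E3) : E3 →L[ℝ] E3 →L[ℝ] ℝ :=
  (LinearMap.mk₂ ℝ (fun a b : E3 => inner ℝ w (cross a b))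
    (fun a a' b => by simp only [inner_cross, PiLp.add_apply]; ring)
    (fun r a b => by simp only [inner_cross, PiLp.smul_apply, smul_eq_mul]; ring)
    (fun a b b' => by simp only [inner_cross, PiLp.add_apply]; ring)
    (fun r a b => by
      simp only [inner_cross, PiLp.smul_apply, smul_eq_mul]; ring)).toContinuousBilinearMap

theorem tripleProduct_apply (w a b : E3) : tripleProduct w a b = inner ℝ w (cross a b) := rfl

theorem tripleProduct_swap (w a b : E3) : tripleProduct w b a = -tripleProduct w a b := by
  simp only [tripleProduct_apply, inner_cross]
  ring

theorem sum_tripleProduct_smul (w a b c : E3) :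
    tripleProduct w b c • a + tripleProduct w c a • b + tripleProduct w a b • c =
      inner ℝ a (cross b c) • w := by
  ext i
  simp only [tripleProduct_apply, inner_cross, PiLp.add_apply, PiLp.smul_apply, smul_eq_mul]
  fin_cases i <;> simp only [Fin.zero_eta, Fin.mk_one, Fin.reduceFinMk] <;> ring

/-- The closed unit cube. -/
abbrev cube (n : ℕ) : Set (Fin n → ℝ) := Icc 0 1

theorem uniqueDiffOn_cube (n : ℕ) : UniqueDiffOn ℝ (cube n) := by
  rw [cube, ← Set.pi_univ_Icc]
  exact UniqueDiffOn.univ_pi fun _ => uniqueDiffOn_Icc one_pos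

theorem interior_cube (n : ℕ) : interior (cube n) = Set.pi univ fun _ => Ioo (0 : ℝ) 1 := by
  rw [cube, ← Set.pi_univ_Icc, interior_pi_set finite_univ]
  simp only [Pi.zero_apply, Pi.one_apply, interior_Icc]

theorem interior_cube_ae_eq (n : ℕ) : interior (cube n) =ᵐ[volume] cube n := by
  rw [interior_cube]
  exact Measure.univ_pi_Ioo_ae_eq_Icc (f := (0 : Fin n → ℝ)) (g := 1)

/-- The partial derivative `∂ₖF` of a map of the closed cube, one-sided at the boundary. -/
def partialDeriv (F : (Fin 3 → ℝ) → E3) (k : Fin 3) (u : Fin 3 → ℝ) : E3 :=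
  fderivWithin ℝ F (cube 3) u (Pi.single k 1)

/-- The Jacobian determinant of a map of the closed cube. -/
def jacobian (F : (Fin 3 → ℝ) → E3) (u : Fin 3 → ℝ) : ℝ :=
  inner ℝ (partialDeriv F 0 u) (cross (partialDeriv F 1 u) (partialDeriv F 2 u))

/-- The component in direction `w` of the surface element `∂ₖ₊₁F × ∂ₖ₊₂F` of the coordinate
surfaces orthogonal to the `k`-th axis; indices are taken modulo `3`. -/
def surfaceElement (F : (Fin 3 → ℝ) → E3) (w : E3) (k : Fin 3) (u : Fin 3 → ℝ) : ℝ :=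
  tripleProduct w (partialDeriv F (k + 1) u) (partialDeriv F (k + 2) u)

section SingularCube

variable {F : (Fin 3 → ℝ) → E3}

theorem sum_surfaceElement_smul_partialDeriv (w : E3) (u : Fin 3 → ℝ) :
    ∑ k, surfaceElement F w k u • partialDeriv F k u = jacobian F u • w := by
  rw [Fin.sum_univ_three]
  exact sum_tripleProduct_smul w _ _ _

section Continuity

variable (hF : ContDiffOn ℝ 1 F (cube 3))
include hF

theorem continuousOn_partialDeriv (k : Fin 3) : ContinuousOn (partialDeriv F k) (cube 3) :=
  (hF.continuousOn_fderivWithin (uniqueDiffOn_cube 3) le_rfl).clm_apply continuousOn_const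

theorem continuousOn_surfaceElement (w : E3) (k : Fin 3) :
    ContinuousOn (surfaceElement F w k) (cube 3) :=
  ((tripleProduct w).continuous.comp_continuousOn (continuousOn_partialDeriv hF _)).clm_apply
    (continuousOn_partialDeriv hF _)

theorem continuousOn_jacobian : ContinuousOn (jacobian F) (cube 3) := by
  have hcoord (k i : Fin 3) : ContinuousOn (fun u => partialDeriv F k u i) (cube 3) :=
    (EuclideanSpace.proj (𝕜 := ℝ) i).continuous.comp_continuousOn (continuousOn_partialDeriv hF k)
  unfold jacobian
  simp only [inner_cross]
  fun_prop

end Continuity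

section Derivatives

variable (hF : ContDiffOn ℝ 2 F (cube 3)) {u : Fin 3 → ℝ} (hu : u ∈ interior (cube 3))
include hF hu

theorem hasFDerivAt_partialDeriv (k : Fin 3) :
    HasFDerivAt (partialDeriv F k) ((fderiv ℝ (fderiv ℝ F) u).flip (Pi.single k 1)) u := by
  have hF' : DifferentiableAt ℝ (fderiv ℝ F) u :=
    ((hF.contDiffAt (mem_interior_iff_mem_nhds.1 hu)).fderiv_right (m := 1)
      (by norm_num)).differentiableAt one_ne_zero
  have hnear : partialDeriv F k =ᶠ[𝓝 u] fun v => fderiv ℝ F v (Pi.single k 1) := by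
    filter_upwards [isOpen_interior.mem_nhds hu] with v hv
    rw [partialDeriv, fderivWithin_of_mem_nhds (mem_interior_iff_mem_nhds.1 hv)]
  refine HasFDerivAt.congr_of_eventuallyEq ?_ hnear
  refine (hF'.hasFDerivAt.clm_apply (hasFDerivAt_const _ u)).congr_fderiv ?_
  ext v
  simp

theorem fderiv_partialDeriv_comm (j k : Fin 3) :
    fderiv ℝ (partialDeriv F j) u (Pi.single k 1) =
      fderiv ℝ (partialDeriv F k) u (Pi.single j 1) := by
  rw [(hasFDerivAt_partialDeriv hF hu j).fderiv, (hasFDerivAt_partialDeriv hF hu k).fderiv]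
  exact (hF.contDiffAt (mem_interior_iff_mem_nhds.1 hu)).isSymmSndFDerivAt
    (minSmoothness_of_isRCLikeNormedField).le _ _

theorem hasFDerivAt_surfaceElement (w : E3) (k : Fin 3) :
    HasFDerivAt (surfaceElement F w k)
      ((tripleProduct w).precompR _ (partialDeriv F (k + 1) u) (fderiv ℝ (partialDeriv F (k + 2)) u)
        + (tripleProduct w).precompL _ (fderiv ℝ (partialDeriv F (k + 1)) u)
          (partialDeriv F (k + 2) u)) u :=
  (tripleProduct w).hasFDerivAt_of_bilinear
    (hasFDerivAt_partialDeriv hF hu _).differentiableAt.hasFDerivAt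
    (hasFDerivAt_partialDeriv hF hu _).differentiableAt.hasFDerivAt

/-- The Piola identity: the second derivatives cancel in pairs. -/
theorem sum_fderiv_surfaceElement (w : E3) :
    ∑ k, fderiv ℝ (surfaceElement F w k) u (Pi.single k 1) = 0 := by
  simp only [(hasFDerivAt_surfaceElement hF hu w _).fderiv, add_apply,
    ContinuousLinearMap.precompR_apply, ContinuousLinearMap.precompL_apply,
    ContinuousLinearMap.compL_apply, ContinuousLinearMap.comp_apply, Fin.sum_univ_three,
    Fin.isValue, zero_add, Fin.reduceAdd]
  rw [fderiv_partialDeriv_comm hF hu 2 0, fderiv_partialDeriv_comm hF hu 1 0,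
    fderiv_partialDeriv_comm hF hu 2 1]
  linear_combination
    tripleProduct_swap w (partialDeriv F 1 u) (fderiv ℝ (partialDeriv F 0) u (Pi.single 2 1)) +
      tripleProduct_swap w (partialDeriv F 2 u) (fderiv ℝ (partialDeriv F 0) u (Pi.single 1 1)) +
      tripleProduct_swap w (partialDeriv F 0 u) (fderiv ℝ (partialDeriv F 1) u (Pi.single 2 1))

theorem hasFDerivAt_mul_surfaceElement {φ : E3 → ℝ} (hφ : DifferentiableAt ℝ φ (F u)) (w : E3)
    (k : Fin 3) :
    HasFDerivAt (fun v => φ (F v) * surfaceElement F w k v)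
      (φ (F u) • fderiv ℝ (surfaceElement F w k) u +
        surfaceElement F w k u • (fderiv ℝ φ (F u) ∘L fderivWithin ℝ F (cube 3) u)) u := by
  have hcube : cube 3 ∈ 𝓝 u := mem_interior_iff_mem_nhds.1 hu
  have hF' : HasFDerivAt F (fderivWithin ℝ F (cube 3) u) u :=
    ((hF.differentiableOn two_ne_zero) u (interior_subset hu)).hasFDerivWithinAt.hasFDerivAt hcube
  exact (hφ.hasFDerivAt.comp u hF').mul
    (hasFDerivAt_surfaceElement hF hu w k).differentiableAt.hasFDerivAt

theorem sum_fderiv_mul_surfaceElement {φ : E3 → ℝ} (hφ : DifferentiableAt ℝ φ (F u)) (w : E3) :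
    ∑ k, fderiv ℝ (fun v => φ (F v) * surfaceElement F w k v) u (Pi.single k 1) =
      fderiv ℝ φ (F u) w * jacobian F u := by
  calc ∑ k, fderiv ℝ (fun v => φ (F v) * surfaceElement F w k v) u (Pi.single k 1)
      = φ (F u) * ∑ k, fderiv ℝ (surfaceElement F w k) u (Pi.single k 1) +
          fderiv ℝ φ (F u) (∑ k, surfaceElement F w k u • partialDeriv F k u) := by
        simp only [(hasFDerivAt_mul_surfaceElement hF hu hφ w _).fderiv, add_apply, smul_apply,
          ContinuousLinearMap.comp_apply, smul_eq_mul, Finset.sum_add_distrib, Finset.mul_sum,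
          map_sum, map_smul, partialDeriv]
    _ = fderiv ℝ φ (F u) w * jacobian F u := by
        rw [sum_fderiv_surfaceElement hF hu, sum_surfaceElement_smul_partialDeriv, map_smul,
          smul_eq_mul, mul_zero, zero_add, mul_comm]

end Derivatives

theorem integral_divergence_cube (hF : ContDiffOn ℝ 2 F (cube 3)) {φ : E3 → ℝ}
    (hφ : ContDiff ℝ 1 φ) (w : E3) :
    ∫ u in cube 3, fderiv ℝ φ (F u) w * jacobian F u =
      ∑ k : Fin 3, ((∫ x in cube 2, φ (F (k.insertNth 1 x)) *
          surfaceElement F w k (k.insertNth 1 x)) -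
        ∫ x in cube 2, φ (F (k.insertNth 0 x)) * surfaceElement F w k (k.insertNth 0 x)) := by
  have hF₁ : ContDiffOn ℝ 1 F (cube 3) := hF.of_le one_le_two
  have hdiff (x : E3) : DifferentiableAt ℝ φ x := hφ.differentiable one_ne_zero x
  have hcont : ContinuousOn (fun u => fderiv ℝ φ (F u) w * jacobian F u) (cube 3) :=
    (((hφ.continuous_fderiv one_ne_zero).comp_continuousOn hF.continuousOn).clm_apply
      continuousOn_const).mul (continuousOn_jacobian hF₁)
  have hae : (fun u => ∑ k, fderiv ℝ (fun v => φ (F v) * surfaceElement F w k v) u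
      (Pi.single k 1)) =ᵐ[volume.restrict (cube 3)]
      fun u => fderiv ℝ φ (F u) w * jacobian F u := by
    rw [← Measure.restrict_congr_set (interior_cube_ae_eq 3)]
    filter_upwards [ae_restrict_mem isOpen_interior.measurableSet] with u hu
    exact sum_fderiv_mul_surfaceElement hF hu (hdiff _) w
  rw [← integral_congr_ae hae]
  refine integral_divergence_of_hasFDerivAt_off_countable' (0 : Fin 3 → ℝ) 1 zero_le_one
    (fun k u => φ (F u) * surfaceElement F w k u)
    (fun k u => fderiv ℝ (fun v => φ (F v) * surfaceElement F w k v) u) ∅ countable_empty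
    (fun k => (hφ.continuous.comp_continuousOn hF.continuousOn).mul
      (continuousOn_surfaceElement hF₁ w k)) (fun u hu k => ?_)
    ((hcont.integrableOn_compact isCompact_Icc).congr hae.symm)
  have hu' : u ∈ interior (cube 3) := by
    rw [interior_cube]
    exact hu.1
  exact (hasFDerivAt_mul_surfaceElement hF hu' (hdiff _) w k).differentiableAt.hasFDerivAt

theorem volume_image_cube_boundary (hF : DifferentiableOn ℝ F (cube 3)) :
    volume (F '' (cube 3 \ interior (cube 3))) = 0 :=
  volume_image_euclidean_eq_zero (hF.mono sdiff_subset)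
    (ae_le_set.1 (interior_cube_ae_eq 3).symm.le)

theorem image_interior_cube_ae_eq (hF : DifferentiableOn ℝ F (cube 3)) :
    F '' interior (cube 3) =ᵐ[volume] F '' cube 3 := by
  refine (image_mono interior_subset).eventuallyLE.antisymm <| ae_le_set.2 <|
    measure_mono_null ?_ (volume_image_cube_boundary hF)
  rintro _ ⟨⟨u, hu, rfl⟩, hn⟩
  exact ⟨u, ⟨hu, fun hu' => hn ⟨u, hu', rfl⟩⟩, rfl⟩

theorem integral_image_cube (hF : DifferentiableOn ℝ F (cube 3))
    (hinj : InjOn F (interior (cube 3))) (hpos : ∀ u ∈ interior (cube 3), 0 < jacobian F u)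
    (h : E3 → ℝ) :
    ∫ y in F '' cube 3, h y = ∫ u in cube 3, h (F u) * jacobian F u := by
  rw [← setIntegral_congr_set (image_interior_cube_ae_eq hF),
    ← setIntegral_congr_set (interior_cube_ae_eq 3),
    setIntegral_image_euclidean isOpen_interior.measurableSet
      (fun u hu => ((hF u (interior_subset hu)).hasFDerivWithinAt.mono interior_subset)) hinj]
  refine setIntegral_congr_fun isOpen_interior.measurableSet fun u hu => ?_
  have hdet := det_equiv_comp (fderivWithin ℝ F (cube 3) u)
  change _ = jacobian F u at hdet
  simp only [hdet, abs_of_pos (hpos u hu), smul_eq_mul, mul_comm]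

end SingularCube

/-- The linear part of the affine parametrisation `face k top`. -/
def faceLinear (k : Fin 3) (top : Bool) : (Fin 2 → ℝ) →L[ℝ] (Fin 3 → ℝ) :=
  ContinuousLinearMap.pi fun j =>
    if j = k then 0
    else if j = k + 1 then (if top then .proj 0 else .proj 1)
    else (if top then .proj 1 else .proj 0)

theorem hasFDerivAt_face (k : Fin 3) (top : Bool) (u : Fin 2 → ℝ) :
    HasFDerivAt (face k top) (faceLinear k top) u := by
  have hproj (i : Fin 2) : HasFDerivAt (fun u : Fin 2 → ℝ => u i)
      (.proj (R := ℝ) (φ := fun _ : Fin 2 => ℝ) i) u :=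
    hasFDerivAt_apply i u
  refine hasFDerivAt_pi.2 fun j => ?_
  unfold face
  split_ifs
  exacts [hasFDerivAt_const _ _, hasFDerivAt_const _ _, hproj 0, hproj 1, hproj 1, hproj 0]

theorem faceLinear_single_zero (k : Fin 3) (top : Bool) :
    faceLinear k top (Pi.single 0 1) = Pi.single (if top then k + 1 else k + 2) 1 := by
  ext j
  fin_cases k <;> fin_cases j <;> cases top <;> simp [faceLinear]

theorem faceLinear_single_one (k : Fin 3) (top : Bool) :
    faceLinear k top (Pi.single 1 1) = Pi.single (if top then k + 2 else k + 1) 1 := by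
  ext j
  fin_cases k <;> fin_cases j <;> cases top <;> simp [faceLinear]

theorem exists_perm_face_eq_insertNth (k : Fin 3) (top : Bool) :
    ∃ e : Equiv.Perm (Fin 2), ∀ u : Fin 2 → ℝ,
      face k top u = k.insertNth (α := fun _ => ℝ) (if top then 1 else 0) (u ∘ e) := by
  refine ⟨if (k = 1) = (top = true) then Equiv.swap 0 1 else Equiv.refl _, fun u => ?_⟩
  ext j
  fin_cases k <;> cases top <;> fin_cases j <;> simp [face, Fin.insertNth, Fin.succAboveCases]

theorem setIntegral_cube_comp_perm {n : ℕ} {G : Type*} [NormedAddCommGroup G] [NormedSpace ℝ G]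
    (e : Equiv.Perm (Fin n)) (h : (Fin n → ℝ) → G) :
    ∫ u in cube n, h (u ∘ e) = ∫ u in cube n, h u := by
  have hpre : (MeasurableEquiv.arrowCongr' e.symm (MeasurableEquiv.refl ℝ)) ⁻¹' cube n =
      cube n := by
    ext u
    have hcoord (i : Fin n) :
        MeasurableEquiv.arrowCongr' e.symm (MeasurableEquiv.refl ℝ) u (e.symm i) = u i :=
      congrArg u (e.apply_symm_apply i)
    exact ⟨fun hu => ⟨fun i => hcoord i ▸ hu.1 (e.symm i), fun i => hcoord i ▸ hu.2 (e.symm i)⟩,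
      fun hu => ⟨fun i => hu.1 (e i), fun i => hu.2 (e i)⟩⟩
  have hint := (volume_preserving_arrowCongr' e.symm (MeasurableEquiv.refl ℝ)
    (.id volume)).setIntegral_preimage_emb (MeasurableEquiv.measurableEmbedding _) h (cube n)
  rwa [hpre] at hint

namespace Region

variable (τ : Region) (i : τ.ι)

theorem inner_normal_facePatch (w : E3) (k : Fin 3) (top : Bool) {u : Fin 2 → ℝ}
    (hu : u ∈ cube 2) : inner ℝ w ((τ.facePatch i k top).normal u) =
      (if top then 1 else -1) * surfaceElement (τ.cell i) w k (face k top u) := by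
  have hderiv : fderivWithin ℝ (τ.facePatch i k top).toFun (cube 2) u =
      fderivWithin ℝ (τ.cell i) (cube 3) (face k top u) ∘L faceLinear k top :=
    (((τ.smooth i).differentiableOn (by simp) _ (mapsTo_face k top hu)).hasFDerivWithinAt.comp u
      (hasFDerivAt_face k top u).hasFDerivWithinAt (mapsTo_face k top)).fderivWithin
      (uniqueDiffOn_cube 2 u hu)
  rw [Patch.normal, hderiv, ContinuousLinearMap.comp_apply, ContinuousLinearMap.comp_apply,
    faceLinear_single_zero, faceLinear_single_one, ← tripleProduct_apply]
  cases top
  · rw [if_neg Bool.false_ne_true, if_neg Bool.false_ne_true, if_neg Bool.false_ne_true,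
      neg_one_mul, tripleProduct_swap]
    rfl
  · rw [if_pos rfl, if_pos rfl, if_pos rfl, one_mul]
    rfl

theorem integral_facePatch (φ : E3 → ℝ) (w : E3) (k : Fin 3) (top : Bool) :
    ∫ u in cube 2, φ ((τ.facePatch i k top).toFun u) *
        inner ℝ w ((τ.facePatch i k top).normal u) =
      (if top then 1 else -1) * ∫ x in cube 2,
        φ (τ.cell i (k.insertNth (if top then 1 else 0) x)) *
          surfaceElement (τ.cell i) w k (k.insertNth (if top then 1 else 0) x) := by
  obtain ⟨e, he⟩ := exists_perm_face_eq_insertNth k top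
  rw [← setIntegral_cube_comp_perm e fun x =>
      φ (τ.cell i (k.insertNth (if top then 1 else 0) x)) *
        surfaceElement (τ.cell i) w k (k.insertNth (if top then 1 else 0) x),
    ← integral_const_mul]
  refine setIntegral_congr_fun measurableSet_Icc fun u hu => ?_
  rw [τ.inner_normal_facePatch i w k top hu, ← he]
  exact mul_left_comm _ _ _

theorem sum_integral_facePatch {φ : E3 → ℝ} (hφ : ContDiff ℝ 1 φ) (w : E3) :
    ∑ k : Fin 3, ∑ top : Bool, ∫ u in cube 2, φ ((τ.facePatch i k top).toFun u) *
        inner ℝ w ((τ.facePatch i k top).normal u) =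
      ∫ u in cube 3, fderiv ℝ φ (τ.cell i u) w * jacobian (τ.cell i) u := by
  rw [integral_divergence_cube ((τ.smooth i).of_le (WithTop.coe_le_coe.2 le_top)) hφ w]
  refine Finset.sum_congr rfl fun k _ => ?_
  rw [Fintype.sum_bool, integral_facePatch, integral_facePatch, if_pos rfl, if_pos rfl,
    if_neg Bool.false_ne_true, if_neg Bool.false_ne_true, one_mul, neg_one_mul, sub_eq_add_neg]

end Region

/-! ### The surface function is the gradient of a mollified indicator -/

theorem Patch.inner_surfaceFun (σ : Patch) (s : ScalarTest) (x w : E3) :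
    inner ℝ w (σ.surfaceFun s x) =
      ∫ u in cube 2, s (x - σ.toFun u) * inner ℝ w (σ.normal u) := by
  have hint : IntegrableOn (fun u => s (x - σ.toFun u) • σ.normal u) (cube 2) :=
    ContinuousOn.integrableOn_compact isCompact_Icc <|
      (s.continuous.comp_continuousOn (continuousOn_const.sub σ.smooth.continuousOn)).smul
        σ.continuousOn_normal
  change inner ℝ w (∫ u in cube 2, s (x - σ.toFun u) • σ.normal u) = _
  rw [← integral_inner hint]
  simp only [inner_smul_right]

theorem hasFDerivAt_setIntegral_comp_sub {K : Set E3} (hK : IsCompact K) (s : ScalarTest)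
    (x : E3) :
    HasFDerivAt (fun z => ∫ y in K, s (z - y)) (∫ y in K, fderiv ℝ s (x - y)) x := by
  have hs : ContDiff ℝ 1 (s : E3 → ℝ) := s.contDiff.of_le (by exact_mod_cast le_top)
  have hs' : Continuous (fderiv ℝ s) := hs.continuous_fderiv one_ne_zero
  obtain ⟨C, hC⟩ := hs'.bounded_above_of_compact_support (s.hasCompactSupport.fderiv ℝ)
  have hint (z : E3) : IntegrableOn (fun y => s (z - y)) K :=
    (s.continuous.comp (continuous_const.sub continuous_id)).continuousOn.integrableOn_compact hK
  have hint' : IntegrableOn (fun y => fderiv ℝ s (x - y)) K :=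
    (hs'.comp (continuous_const.sub continuous_id)).continuousOn.integrableOn_compact hK
  exact hasFDerivAt_integral_of_dominated_of_fderiv_le (F := fun z y => s (z - y))
    (F' := fun z y => fderiv ℝ s (z - y)) (bound := fun _ => C) univ_mem
    (Eventually.of_forall fun z => (hint z).aestronglyMeasurable) (hint x)
    hint'.aestronglyMeasurable (Eventually.of_forall fun y z _ => hC _)
    (integrableOn_const hK.measure_lt_top.ne) (Eventually.of_forall fun y z _ =>
      (hs.differentiable one_ne_zero (z - y)).hasFDerivAt.comp z ((hasFDerivAt_id z).sub_const y))

namespace Region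

variable (τ : Region)

theorem isCompact_carrier : IsCompact τ.carrier :=
  isCompact_iUnion fun i => isCompact_Icc.image_of_continuousOn (τ.smooth i).continuousOn

theorem differentiableOn_cell (i : τ.ι) : DifferentiableOn ℝ (τ.cell i) (cube 3) :=
  (τ.smooth i).differentiableOn (by simp)

theorem injOn_cell (i : τ.ι) : InjOn (τ.cell i) (interior (cube 3)) :=
  fun u hu v hv h => (τ.injective i i u hu v hv h).2

theorem jacobian_cell_pos (i : τ.ι) {u : Fin 3 → ℝ} (hu : u ∈ interior (cube 3)) :
    0 < jacobian (τ.cell i) u := by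
  simp only [jacobian, partialDeriv, fderivWithin_of_mem_nhds (mem_interior_iff_mem_nhds.1 hu)]
  exact τ.oriented i u hu

theorem pairwise_aedisjoint_cell :
    Pairwise (Function.onFun (AEDisjoint volume) fun i => τ.cell i '' cube 3) := by
  intro i j hij
  refine measure_mono_null ?_ (measure_union_null
    (volume_image_cube_boundary (τ.differentiableOn_cell i))
    (volume_image_cube_boundary (τ.differentiableOn_cell j)))
  rintro _ ⟨⟨u, hu, rfl⟩, ⟨v, hv, hvu⟩⟩
  by_cases hu' : u ∈ interior (cube 3)
  · by_cases hv' : v ∈ interior (cube 3)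
    · exact absurd (τ.injective j i v hv' u hu' hvu).1.symm hij
    · exact Or.inr ⟨v, ⟨hv, hv'⟩, hvu⟩
  · exact Or.inl ⟨u, ⟨hu, hu'⟩, rfl⟩

theorem integral_carrier {h : E3 → ℝ} (hh : IntegrableOn h τ.carrier) :
    ∫ y in τ.carrier, h y = ∑ i, ∫ u in cube 3, h (τ.cell i u) * jacobian (τ.cell i) u := by
  have hcell (i : τ.ι) : NullMeasurableSet (τ.cell i '' cube 3) :=
    (isCompact_Icc.image_of_continuousOn
      (τ.smooth i).continuousOn).measurableSet.nullMeasurableSet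
  rw [carrier, integral_iUnion_ae hcell τ.pairwise_aedisjoint_cell hh, tsum_fintype]
  exact Finset.sum_congr rfl fun i _ => integral_image_cube (τ.differentiableOn_cell i)
    (τ.injOn_cell i) (fun u hu => τ.jacobian_cell_pos i hu) h

theorem surfaceFun_apply (s : ScalarTest) (x : E3) :
    τ.surfaceFun s x = ∑ i, ∑ k, ∑ top, (τ.facePatch i k top).surfaceFun s x := by
  have hsum {J : Type} (t : Finset J) (f : J → VectorTest) : (∑ j ∈ t, f j) x = ∑ j ∈ t, f j x :=
    map_sum ((Pi.evalAddMonoidHom (fun _ : E3 => E3) x).comp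
      (FunLike.coeAddMonoidHom VectorTest E3 E3)) f t
  simp only [surfaceFun, hsum]

theorem inner_surfaceFun (s : ScalarTest) (x w : E3) :
    inner ℝ w (τ.surfaceFun s x) = -∫ y in τ.carrier, fderiv ℝ s (x - y) w := by
  have hs : ContDiff ℝ 1 (s : E3 → ℝ) := s.contDiff.of_le (by exact_mod_cast le_top)
  have hφ : ContDiff ℝ 1 fun y => s (x - y) := hs.comp (contDiff_const.sub contDiff_id)
  have hfderiv (y : E3) : fderiv ℝ (fun y => s (x - y)) y w = -fderiv ℝ s (x - y) w := by
    have h := ((hs.differentiable one_ne_zero (x - y)).hasFDerivAt).comp y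
      ((hasFDerivAt_id y).const_sub x)
    rw [HasFDerivAt.fderiv (f := fun y => s (x - y)) h, ContinuousLinearMap.comp_apply,
      neg_apply, ContinuousLinearMap.id_apply, map_neg]
  have hint : IntegrableOn (fun y => fderiv ℝ (fun y => s (x - y)) y w) τ.carrier :=
    ((hφ.continuous_fderiv one_ne_zero).clm_apply
      continuous_const).continuousOn.integrableOn_compact τ.isCompact_carrier
  calc inner ℝ w (τ.surfaceFun s x)
      = ∑ i, ∑ k, ∑ top, ∫ u in cube 2, s (x - (τ.facePatch i k top).toFun u) *
          inner ℝ w ((τ.facePatch i k top).normal u) := by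
        simp only [surfaceFun_apply, inner_sum, Patch.inner_surfaceFun]
    _ = ∑ i, ∫ u in cube 3, fderiv ℝ (fun y => s (x - y)) (τ.cell i u) w *
          jacobian (τ.cell i) u :=
        Finset.sum_congr rfl fun i _ => τ.sum_integral_facePatch i hφ w
    _ = ∫ y in τ.carrier, fderiv ℝ (fun y => s (x - y)) y w := (τ.integral_carrier hint).symm
    _ = -∫ y in τ.carrier, fderiv ℝ s (x - y) w := by simp only [hfderiv, integral_neg]

/-- The mollified indicator function of the region, whose negative gradient is the surface
function. -/
def potential (s : ScalarTest) : ScalarTest where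
  toFun x := ∫ y in τ.carrier, s (x - y)
  contDiff' := by
    have hs : ContDiff ℝ ∞ (s : E3 → ℝ) := s.contDiff
    exact contDiff_setIntegral_of_compact volume τ.isCompact_carrier (fun y : E3 => y)
      continuousOn_id (fun z : E3 × E3 => s (z.2 - z.1)) (by fun_prop)
  hasCompactSupport' := by
    refine HasCompactSupport.of_support_subset_isCompact
      (τ.isCompact_carrier.add s.hasCompactSupport.isCompact) fun x hx => ?_
    by_contra hn
    refine hx (setIntegral_eq_zero_of_forall_eq_zero fun y hy => ?_)
    by_contra h
    exact hn ⟨y, hy, x - y, subset_tsupport _ h, add_sub_cancel y x⟩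
  tsupport_subset' := fun _ _ => trivial

theorem potential_apply (s : ScalarTest) (x : E3) :
    τ.potential s x = ∫ y in τ.carrier, s (x - y) := rfl

theorem fderiv_potential (s : ScalarTest) (x w : E3) :
    fderiv ℝ (τ.potential s) x w = ∫ y in τ.carrier, fderiv ℝ s (x - y) w := by
  have hs' : Continuous (fderiv ℝ s) :=
    (s.contDiff.of_le (by exact_mod_cast le_top)).continuous_fderiv one_ne_zero
  have hint : IntegrableOn (fun y => fderiv ℝ s (x - y)) τ.carrier :=
    (hs'.comp (continuous_const.sub continuous_id)).continuousOn.integrableOn_compact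
      τ.isCompact_carrier
  have hderiv : HasFDerivAt (τ.potential s) (∫ y in τ.carrier, fderiv ℝ s (x - y)) x :=
    hasFDerivAt_setIntegral_comp_sub τ.isCompact_carrier s x
  rw [hderiv.fderiv, ContinuousLinearMap.integral_apply hint]

theorem surfaceFun_eq_neg_grad_potential (s : ScalarTest) :
    τ.surfaceFun s = -grad (τ.potential s) := by
  ext1 x
  refine ext_inner_left ℝ fun w => ?_
  change _ = inner ℝ w (-grad (τ.potential s) x)
  rw [inner_surfaceFun, inner_neg_right, inner_grad, fderiv_potential]

section Potential

variable {s : ScalarTest} {δ : ℝ} (hs : tsupport s ⊆ Metric.ball 0 δ) {z : E3}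
include hs

theorem potential_eq_integral_of_ball_subset (hz : Metric.ball z δ ⊆ τ.carrier) :
    τ.potential s z = ∫ y, s y := by
  rw [potential_apply, setIntegral_eq_integral_of_forall_compl_eq_zero,
    integral_sub_left_eq_self (fun y => s y)]
  refine fun y hy => image_eq_zero_of_notMem_tsupport fun h => hy (hz ?_)
  rw [Metric.mem_ball', dist_eq_norm]
  exact mem_ball_zero_iff.1 (hs h)

theorem potential_eq_zero_of_ball_subset_compl (hz : Metric.ball z δ ⊆ τ.carrierᶜ) :
    τ.potential s z = 0 := by
  refine setIntegral_eq_zero_of_forall_eq_zero fun y hy =>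
    image_eq_zero_of_notMem_tsupport fun h => hz ?_ hy
  rw [Metric.mem_ball', dist_eq_norm]
  exact mem_ball_zero_iff.1 (hs h)

end Potential

theorem exists_pos_eventually_potential_eq {x : E3} (hx : x ∉ τ.surface) :
    ∃ δ > 0, ∀ s : ScalarTest, ∫ y, s y = 1 → tsupport s ⊆ Metric.ball 0 δ →
      ∀ᶠ z in 𝓝 x, τ.potential s z = (interior τ.carrier).indicator 1 x := by
  have hball {U : Set E3} (hU : U ∈ 𝓝 x) :
      ∃ δ > 0, ∀ᶠ z in 𝓝 x, Metric.ball z δ ⊆ U := by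
    obtain ⟨r, hr, hrU⟩ := Metric.mem_nhds_iff.1 hU
    refine ⟨r / 2, half_pos hr, ?_⟩
    filter_upwards [Metric.ball_mem_nhds x (half_pos hr)] with z hz
    refine (Metric.ball_subset_ball' ?_).trans hrU
    linarith [Metric.mem_ball.1 hz]
  by_cases hin : x ∈ interior τ.carrier
  · obtain ⟨δ, hδ, hsub⟩ := hball (mem_interior_iff_mem_nhds.1 hin)
    refine ⟨δ, hδ, fun s hone hs => hsub.mono fun z hz => ?_⟩
    rw [indicator_of_mem hin, τ.potential_eq_integral_of_ball_subset hs hz, hone, Pi.one_apply]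
  · have hout : x ∉ τ.carrier := fun h => hx <| by
      rw [surface, τ.isCompact_carrier.isClosed.frontier_eq]
      exact ⟨h, hin⟩
    obtain ⟨δ, hδ, hsub⟩ := hball (τ.isCompact_carrier.isClosed.isOpen_compl.mem_nhds hout)
    refine ⟨δ, hδ, fun s _ hs => hsub.mono fun z hz => ?_⟩
    rw [indicator_of_notMem hin, τ.potential_eq_zero_of_ball_subset_compl hs hz]

end Region

theorem notMem_tsupport_neg_grad {S : ScalarTest} {x : E3} {c : ℝ}
    (h : ∀ᶠ z in 𝓝 x, S z = c) : x ∉ tsupport (-grad S : VectorTest) := by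
  rw [notMem_tsupport_iff_eventuallyEq]
  filter_upwards [h.eventually_nhds] with z hz
  have hfderiv : fderiv ℝ S z = 0 :=
    (EventuallyEq.fderiv_eq (f := fun _ => c) hz).trans (fderiv_const_apply c)
  change -gradient S z = 0
  rw [gradient, hfderiv, map_zero, neg_zero]

/-! ### Closing a bridge off a compact set -/

/-- The rescaled density `x ↦ k⁻³ ρ(x / k)`; it is zero for `k = 0`, since `0⁻¹ = 0`. -/
def rescale (ρ : ScalarTest) (k : ℝ) : ScalarTest where
  toFun x := (k⁻¹) ^ 3 * ρ (k⁻¹ • x)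
  contDiff' := contDiff_const.mul (ρ.contDiff.comp (contDiff_const_smul k⁻¹))
  hasCompactSupport' := by
    rcases eq_or_ne k 0 with rfl | hk
    · exact HasCompactSupport.intro isCompact_empty fun x _ => by simp
    · exact (ρ.hasCompactSupport.comp_smul (inv_ne_zero hk)).mul_left (f := fun _ => (k⁻¹) ^ 3)
  tsupport_subset' := fun _ _ => trivial

theorem rescale_apply (ρ : ScalarTest) (k : ℝ) (x : E3) :
    rescale ρ k x = (k⁻¹) ^ 3 * ρ (k⁻¹ • x) := rfl

theorem integral_rescale_mul (ρ : ScalarTest) {k : ℝ} (hk : 0 < k) (h : E3 → ℝ) :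
    ∫ x, rescale ρ k x * h x = ∫ y, ρ y * h (k • y) := by
  have hsubst := Measure.integral_comp_inv_smul_of_nonneg (volume : Measure E3)
    (fun y => (k⁻¹) ^ 3 * (ρ y * h (k • y))) hk.le
  rw [integral_const_mul (_ ^ 3) (fun y => ρ y * h (k • y)), finrank_euclideanSpace_fin,
    smul_eq_mul, ← mul_assoc, ← mul_pow, mul_inv_cancel₀ hk.ne', one_pow, one_mul] at hsubst
  rw [← hsubst]
  simp only [rescale_apply, smul_smul, mul_inv_cancel₀ hk.ne', one_smul, mul_assoc]

theorem tsupport_rescale_subset {ρ : ScalarTest} {k r δ : ℝ} (hk : 0 < k)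
    (hρ : tsupport ρ ⊆ Metric.ball 0 r) (hδ : k * r ≤ δ) :
    tsupport (rescale ρ k) ⊆ Metric.ball 0 δ := by
  intro x hx
  have hx' : k⁻¹ • x ∈ Metric.ball 0 r := hρ <| tsupport_comp_subset_preimage ρ
    (continuous_const_smul k⁻¹) (tsupport_mul_subset_right hx)
  rw [mem_ball_zero_iff, norm_smul, norm_inv, Real.norm_of_nonneg hk.le,
    inv_mul_lt_iff₀ hk] at hx'
  exact mem_ball_zero_iff.2 (hx'.trans_le hδ)

theorem pairing_eq_zero_of_disjoint {f g : VectorTest} {K : Set E3} (hf : tsupport f ⊆ Kᶜ)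
    (hg : tsupport g ⊆ K) : pairing f g = 0 := by
  refine integral_eq_zero_of_ae (Eventually.of_forall fun x => ?_)
  by_cases hx : x ∈ K
  · simp [image_eq_zero_of_notMem_tsupport fun h => hf h hx]
  · simp [image_eq_zero_of_notMem_tsupport fun h => hx (hg h)]

namespace BridgeData

variable {x₁ x₂ : E3} {q : ℝ} (D : BridgeData x₁ x₂ q)

/-- The charge density at the ends `γ(ε)` and `γ(1 - ε)` of the truncated bridge `b_ε`, moved to
the origin. -/
def endProfile (ε : ℝ) : ScalarTest := rescale D.profile (ε * (1 - ε))

theorem pairing_cutoff_grad_endProfile {ε : ℝ} (hε : ε ∈ Ioo (0 : ℝ) (1 / 2)) (S : ScalarTest) :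
    pairing (D.cutoff ε) (grad S) =
      ∫ x, D.endProfile ε x * (S (D.path (1 - ε) + x) - S (D.path ε + x)) := by
  rw [D.pairing_cutoff_grad hε.1 hε.2.le, endProfile,
    integral_rescale_mul _ (mul_pos hε.1 (by linarith [hε.2]))]
  simp only [pathAt, sub_sub_cancel, mul_comm (1 - ε) ε]

theorem eventually_tsupport_endProfile_subset {δ : ℝ} (hδ : 0 < δ) :
    ∀ᶠ ε in 𝓝[>] (0 : ℝ), tsupport (D.endProfile ε) ⊆ Metric.ball 0 δ := by
  filter_upwards [D.tendsto_width.eventually_lt_const hδ, Ioo_mem_nhdsGT one_pos] with ε hwidth hε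
  have hk : 0 < ε * (1 - ε) := mul_pos hε.1 (sub_pos.2 hε.2)
  rw [abs_of_pos hk] at hwidth
  exact tsupport_rescale_subset hk D.profile_support hwidth.le

theorem eventually_hasTransport_source {V : Set E3} (hV : V ∈ 𝓝 x₁) :
    ∀ᶠ ε in 𝓝[>] (0 : ℝ), HasTransport V (D.endProfile ε) x₁ (D.path ε) := by
  obtain ⟨r, hr, hball⟩ := Metric.mem_nhds_iff.1 hV
  filter_upwards [D.tendsto_path_source (Metric.ball_mem_nhds _ (half_pos hr)),
    D.eventually_tsupport_endProfile_subset (half_pos hr)] with ε hpath hsupp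
  exact hasTransport_of_ball_subset hball hsupp (Metric.mem_ball_self (half_pos hr)) hpath

theorem eventually_hasTransport_target {V : Set E3} (hV : V ∈ 𝓝 x₂) :
    ∀ᶠ ε in 𝓝[>] (0 : ℝ), HasTransport V (D.endProfile ε) x₂ (D.path (1 - ε)) :=
  D.reverse.eventually_hasTransport_source hV

theorem exists_divergenceFree {K : Set E3} (hK : IsClosed K) (h₁ : x₁ ∉ K) (h₂ : x₂ ∉ K)
    (hT : Transportable Kᶜ x₂ x₁) :
    ∃ b : VectorTest, (∀ S, pairing b (grad S) = 0) ∧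
      ∀ g : VectorTest, tsupport g ⊆ K → pairing b g = D.fluxFunctional g := by
  obtain ⟨δ, hδ, hT⟩ := hT
  obtain ⟨ε, hcut, hsource, htarget, hsupp, hε⟩ :=
    ((D.eventually_pairing_cutoff_eq hK h₁ h₂).and <|
      (D.eventually_hasTransport_source (hK.isOpen_compl.mem_nhds h₁)).and <|
      (D.eventually_hasTransport_target (hK.isOpen_compl.mem_nhds h₂)).and <|
      (D.eventually_tsupport_endProfile_subset hδ).and
        (Ioo_mem_nhdsGT (one_half_pos (α := ℝ)))).exists
  obtain ⟨c, hc, hcS⟩ := htarget.symm.trans ((hT _ hsupp).trans hsource)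
  refine ⟨D.cutoff ε + c, fun S => ?_, fun g hg => ?_⟩
  · rw [pairing_add_left, D.pairing_cutoff_grad_endProfile hε, hcS,
      ← integral_add (integrable_mul_shift_sub _ _ _ _) (integrable_mul_shift_sub _ _ _ _)]
    simp only [← mul_add, sub_add_sub_cancel, sub_self, mul_zero, integral_zero]
  · rw [pairing_add_left, pairing_eq_zero_of_disjoint hc hg, add_zero, hcut g hg]

end BridgeData

theorem transportable_of_nullhomotopic {x₁ x₂ : E3} {K : Set E3} (hK : IsCompact K)
    (hKx : K ⊆ awayFrom x₁ x₂) (hnull : (ContinuousMap.inclusion hKx).Nullhomotopic) :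
    Transportable Kᶜ x₂ x₁ := by
  have h₁ : x₁ ∉ (awayFrom x₁ x₂ : Set E3) := fun h => h (Or.inl rfl)
  have h₂ : x₂ ∉ (awayFrom x₁ x₂ : Set E3) := fun h => h (Or.inr rfl)
  have hrank : 1 < Module.rank ℝ E3 := by
    rw [← Module.finrank_eq_rank, finrank_euclideanSpace_fin]
    norm_num
  refine transportable_of_isPreconnected hK.isClosed.isOpen_compl
    (connectedComponentIn_subset _ x₂) isPreconnected_connectedComponentIn
    (mem_connectedComponentIn fun h => h₂ (hKx h)) ?_
  rw [connectedComponentIn_compl_eq_of_nullhomotopic hrank hK hKx hnull h₂ h₁]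
  exact mem_connectedComponentIn fun h => h₁ (hKx h)

/-! ### The charged state -/

theorem coe_toGlobal (O : Opens E3) (A : observables O) :
    ((toGlobal O A : observables ⊤) : Op) = A := by
  cases A
  rfl

namespace BridgeData

variable {x₁ x₂ : E3} {q : ℝ} (D : BridgeData x₁ x₂ q)

/-- The gauge bridge, extended to an automorphism of the algebra of all bounded operators. -/
def bridgeAut : Op ≃⋆ₐ[ℂ] Op := Unitary.conjStarAlgAut ℂ Op (unitaryPhase D.fluxFunctional)

theorem isPhaseAut_bridgeAut : IsPhaseAut D.bridgeAut D.fluxFunctional :=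
  isPhaseAut_conj_unitaryPhase _

theorem tendsto_bridgeAut {A : Op} (hA : A ∈ weylAlgebra ⊤) :
    Tendsto (fun ε : ℝ => expA (D.cutoff ε) * A * expA (-D.cutoff ε)) (𝓝[>] 0)
      (𝓝 (D.bridgeAut A)) := by
  simp only [← conj_unitaryA_apply]
  exact IsPhaseAut.tendsto_of_tendsto_phase (fun ε => isPhaseAut_conj_unitaryA (D.cutoff ε))
    D.isPhaseAut_bridgeAut (fun g _ => D.tendsto_pairing_fluxFunctional g) hA

theorem exists_isGaugeBridge : ∃ β, D.IsGaugeBridge β :=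
  ⟨D.isPhaseAut_bridgeAut.restrict ⊤, fun A => D.tendsto_bridgeAut A.2.1⟩

namespace IsGaugeBridge

variable {D} {β : observables ⊤ ≃⋆ₐ[ℂ] observables ⊤}

theorem coe_apply (hβ : D.IsGaugeBridge β) (A : observables ⊤) : (β A : Op) = D.bridgeAut A :=
  tendsto_nhds_unique (hβ A) (D.tendsto_bridgeAut A.2.1)

theorem mem_observables_iff (hβ : D.IsGaugeBridge β) {O : Opens E3} (A : observables ⊤) :
    (A : Op) ∈ observables O ↔ (β A : Op) ∈ observables O := by
  rw [hβ.coe_apply]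
  exact D.isPhaseAut_bridgeAut.mem_observables_iff

theorem apply_chargeDensity (hβ : D.IsGaugeBridge β) (S : ScalarTest) :
    β (chargeDensity ⊤ S fun _ _ => trivial) =
      Complex.exp (Complex.I * D.fluxFunctional (-grad S)) •
        chargeDensity ⊤ S fun _ _ => trivial := by
  refine Subtype.ext ?_
  rw [hβ.coe_apply]
  exact D.isPhaseAut_bridgeAut.map_expE (-grad S)

theorem chargedState_fieldE (hβ : D.IsGaugeBridge β) {ω₀ : observables ⊤ →ₚ[ℂ] ℂ}
    (hcharge : ∀ s : ScalarTest, ω₀ (chargeDensity ⊤ s fun _ _ => trivial) = 1)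
    {S : ScalarTest} {g : VectorTest} (hgS : g = -grad S) (hg : tsupport g ⊆ awayFrom x₁ x₂)
    {c₁ c₂ : ℝ} (h₁ : ∀ᶠ x in 𝓝 x₁, S x = c₁) (h₂ : ∀ᶠ x in 𝓝 x₂, S x = c₂) :
    chargedState x₁ x₂ ω₀ β (fieldE (awayFrom x₁ x₂) g hg) =
      Complex.exp (Complex.I * (q * (c₁ - c₂) : ℝ)) := by
  subst hgS
  change ω₀ (β (chargeDensity ⊤ S fun _ _ => trivial)) = _
  rw [hβ.apply_chargeDensity, map_smul, hcharge, smul_eq_mul, mul_one, map_neg,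
    D.fluxFunctional_grad h₁ h₂, ← mul_neg, neg_sub]

theorem chargedState_chargeDensity (hβ : D.IsGaugeBridge β) {ω₀ : observables ⊤ →ₚ[ℂ] ℂ}
    (hcharge : ∀ s : ScalarTest, ω₀ (chargeDensity ⊤ s fun _ _ => trivial) = 1)
    (s : ScalarTest) (hs : tsupport s ⊆ awayFrom x₁ x₂) :
    chargedState x₁ x₂ ω₀ β (chargeDensity (awayFrom x₁ x₂) s hs) = 1 := by
  have hzero {x : E3} (hx : x ∉ awayFrom x₁ x₂) : ∀ᶠ z in 𝓝 x, s z = 0 :=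
    notMem_tsupport_iff_eventuallyEq.1 fun h => hx (hs h)
  refine (hβ.chargedState_fieldE hcharge rfl _ (hzero fun h => h (Or.inl rfl))
    (hzero fun h => h (Or.inr rfl))).trans ?_
  simp

theorem exists_chargedState_surfaceFun (hβ : D.IsGaugeBridge β) {ω₀ : observables ⊤ →ₚ[ℂ] ℂ}
    (hcharge : ∀ s : ScalarTest, ω₀ (chargeDensity ⊤ s fun _ _ => trivial) = 1)
    (τ : Region) (hτ : τ.surface ⊆ awayFrom x₁ x₂) :
    ∃ δ > 0, ∀ s : ScalarTest, ∫ x, s x = 1 → tsupport s ⊆ Metric.ball 0 δ →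
      ∃ hg : tsupport (τ.surfaceFun s) ⊆ awayFrom x₁ x₂,
        chargedState x₁ x₂ ω₀ β (fieldE (awayFrom x₁ x₂) (τ.surfaceFun s) hg) =
          Complex.exp (Complex.I * (q * ((interior τ.carrier).indicator 1 x₁ -
            (interior τ.carrier).indicator 1 x₂) : ℝ)) := by
  obtain ⟨δ₁, hδ₁, hpot₁⟩ := τ.exists_pos_eventually_potential_eq fun h => hτ h (Or.inl rfl)
  obtain ⟨δ₂, hδ₂, hpot₂⟩ := τ.exists_pos_eventually_potential_eq fun h => hτ h (Or.inr rfl)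
  refine ⟨min δ₁ δ₂, lt_min hδ₁ hδ₂, fun s hs hsupp => ?_⟩
  have h₁ := hpot₁ s hs (hsupp.trans (Metric.ball_subset_ball (min_le_left _ _)))
  have h₂ := hpot₂ s hs (hsupp.trans (Metric.ball_subset_ball (min_le_right _ _)))
  have hgrad := τ.surfaceFun_eq_neg_grad_potential s
  have hg : tsupport (τ.surfaceFun s) ⊆ awayFrom x₁ x₂ := by
    rw [hgrad]
    rintro x hx (rfl | rfl)
    exacts [notMem_tsupport_neg_grad h₁ hx, notMem_tsupport_neg_grad h₂ hx]
  exact ⟨hg, hβ.chargedState_fieldE hcharge hgrad hg h₁ h₂⟩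

theorem exists_inner_unitary (hβ : D.IsGaugeBridge β) {O : Opens E3}
    (hOc : IsCompact (closure (O : Set E3))) (hO : closure (O : Set E3) ⊆ awayFrom x₁ x₂)
    (hnull : (ContinuousMap.inclusion hO).Nullhomotopic) :
    ∃ W : observables ⊤, star W * W = 1 ∧
      ∀ A : observables ⊤, (A : Op) ∈ observables O → β A = star W * (A * W) := by
  obtain ⟨b, hdiv, hflux⟩ := D.exists_divergenceFree isClosed_closure
    (fun h => hO h (Or.inl rfl)) (fun h => hO h (Or.inr rfl))
    (transportable_of_nullhomotopic hOc hO hnull)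
  have hdiv' (S : ScalarTest) : pairing (-b) (grad S) = 0 := by
    rw [pairing_neg_left, hdiv, neg_zero]
  have hstar : star (expA (-b)) = expA b := by rw [star_expA, neg_neg]
  refine ⟨⟨expA (-b), expA_mem_observables (fun _ _ => trivial) hdiv'⟩, Subtype.ext ?_,
    fun A hA => Subtype.ext ?_⟩
  · change star (expA (-b)) * expA (-b) = 1
    rw [hstar, expA_mul_neg]
  · change _ = star (expA (-b)) * ((A : Op) * expA (-b))
    rw [hβ.coe_apply, hstar, ← mul_assoc, ← conj_unitaryA_apply]
    exact D.isPhaseAut_bridgeAut.eqOn_weylAlgebra (isPhaseAut_conj_unitaryA b)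
      (fun g hg => (hflux g (hg.trans subset_closure)).symm) hA.1

theorem exists_vector (hβ : D.IsGaugeBridge β) {ω₀ : observables ⊤ →ₚ[ℂ] ℂ} (hone : ω₀ 1 = 1)
    {O : Opens E3} (hOc : IsCompact (closure (O : Set E3)))
    (hO : closure (O : Set E3) ⊆ awayFrom x₁ x₂)
    (hnull : (ContinuousMap.inclusion hO).Nullhomotopic) :
    ∃ Ψ : ω₀.GNS, ‖Ψ‖ = 1 ∧
      ∀ A : observables (awayFrom x₁ x₂), (A : Op) ∈ observables O →
        chargedState x₁ x₂ ω₀ β A =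
          inner ℂ Ψ (ω₀.gnsStarAlgHom (toGlobal (awayFrom x₁ x₂) A) Ψ) := by
  obtain ⟨W, hW, hβW⟩ := hβ.exists_inner_unitary hOc hO hnull
  refine ⟨ω₀.toPreGNS W, norm_toPreGNS_of_star_mul_self_eq_one ω₀ hone hW, fun A hA => ?_⟩
  rw [inner_gnsStarAlgHom_toPreGNS, ← hβW _ (by rwa [coe_toGlobal])]
  rfl

end IsGaugeBridge

end BridgeData

theorem chargedState_one {x₁ x₂ : E3} {ω₀ : observables ⊤ →ₚ[ℂ] ℂ} (hone : ω₀ 1 = 1)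
    (β : observables ⊤ ≃⋆ₐ[ℂ] observables ⊤) : chargedState x₁ x₂ ω₀ β 1 = 1 := by
  change ω₀ (β (toGlobal _ 1)) = 1
  rw [map_one, map_one, hone]

end StaticCharges

end

open StaticCharges in
theorem mainTheorem3 (x₁ x₂ : E3) (q : ℝ) (D : BridgeData x₁ x₂ q)
    (ω₀ : observables ⊤ →ₚ[ℂ] ℂ) (hone : ω₀ 1 = 1)
    (hcharge : ∀ s : ScalarTest, ω₀ (chargeDensity ⊤ s (fun _ _ => trivial)) = 1) :
    (∃ β, D.IsGaugeBridge β) ∧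
    ∀ β, D.IsGaugeBridge β →
      -- the bridge maps the algebra of the complement of the charges onto itself
      (∀ A : observables ⊤,
        (A : Op) ∈ observables (awayFrom x₁ x₂) ↔ (β A : Op) ∈ observables (awayFrom x₁ x₂)) ∧
      -- `ω_X` is a state
      chargedState x₁ x₂ ω₀ β 1 = 1 ∧
      -- (i) the charge density vanishes away from the charges
      (∀ (s : ScalarTest) (hs : tsupport s ⊆ awayFrom x₁ x₂),
        chargedState x₁ x₂ ω₀ β (chargeDensity (awayFrom x₁ x₂) s hs) = 1) ∧
      -- (ii) Gauss' law
      (∀ τ : Region, τ.surface ⊆ awayFrom x₁ x₂ →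
        ∃ δ > 0, ∀ s : ScalarTest, ∫ x, s x = 1 → tsupport s ⊆ Metric.ball 0 δ →
          ∃ hg : tsupport (τ.surfaceFun s) ⊆ awayFrom x₁ x₂,
            (¬ τ.Encloses x₁ ∧ ¬ τ.Encloses x₂ →
              chargedState x₁ x₂ ω₀ β (fieldE (awayFrom x₁ x₂) (τ.surfaceFun s) hg) = 1) ∧
            (τ.Encloses x₁ ∧ τ.Encloses x₂ →
              chargedState x₁ x₂ ω₀ β (fieldE (awayFrom x₁ x₂) (τ.surfaceFun s) hg) = 1) ∧
            (τ.Encloses x₁ ∧ ¬ τ.Encloses x₂ →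
              chargedState x₁ x₂ ω₀ β (fieldE (awayFrom x₁ x₂) (τ.surfaceFun s) hg) =
                Complex.exp (Complex.I * q)) ∧
            (¬ τ.Encloses x₁ ∧ τ.Encloses x₂ →
              chargedState x₁ x₂ ω₀ β (fieldE (awayFrom x₁ x₂) (τ.surfaceFun s) hg) =
                Complex.exp (-(Complex.I * q)))) ∧
      -- (iii) restrictions to contractible regions are vector states in the GNS representation
      (∀ O : Opens E3, IsCompact (closure (O : Set E3)) →
        ∀ hO : closure (O : Set E3) ⊆ awayFrom x₁ x₂,
          (ContinuousMap.inclusion hO).Nullhomotopic →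
          ∃ Ψ : ω₀.GNS, ‖Ψ‖ = 1 ∧
            ∀ A : observables (awayFrom x₁ x₂), (A : Op) ∈ observables O →
              chargedState x₁ x₂ ω₀ β A =
                inner ℂ Ψ (ω₀.gnsStarAlgHom (toGlobal (awayFrom x₁ x₂) A) Ψ)) := by
  refine ⟨D.exists_isGaugeBridge, fun β hβ => ⟨hβ.mem_observables_iff, chargedState_one hone β,
    hβ.chargedState_chargeDensity hcharge, fun τ hτ => ?_,
    fun O hOc hO hnull => hβ.exists_vector hone hOc hO hnull⟩⟩
  obtain ⟨δ, hδ, hgauss⟩ := hβ.exists_chargedState_surfaceFun hcharge τ hτ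
  refine ⟨δ, hδ, fun s hs hsupp => ?_⟩
  obtain ⟨hg, hvalue⟩ := hgauss s hs hsupp
  refine ⟨hg, ?_, ?_, ?_, ?_⟩ <;> rintro ⟨h₁, h₂⟩ <;> rw [Region.Encloses] at h₁ h₂ <;>
    simp [hvalue, h₁, h₂]
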